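/- Let $K$ be a field. A dialgebra over $K$ is a $K$-vector space $D$ with two bilinear products $\dashv,\vdash$ such that $x\dashv(y\dashv z)=(x\dashv y)\dashv z=x\dashv(y\vdash z)$, $(x\vdash y)\dashv z=x\vdash(y\dashv z)$ and $(x\dashv y)\vdash z=x\vdash(y\vdash z)=(x\vdash y)\vdash z$. A morphism of dialgebras is a $K$-linear map respecting both products. Let $\psi\colon D\to E$ be a morphism of dialgebras over $K$, and regard $E$ as a representation of $D$ via $\psi$ (acting on both sides by $\dashv$ and $\vdash$ of $E$). Let $Y_n$ be the set of planar binary trees with $n+1$ leaves, numbered $0,\dots,n$ from left to right, let $d_iy$ be obtained from $y$ by deleting the $i$th leaf, and write $|$ for the tree with one leaf, $y_1\vee y_2$ for grafting, $[21]=|\vee(|\vee|)$, $[12]=(|\vee|)\vee|$. For $y\in Y_{n+1}$ let $\circ^y_0$ be $\dashv$ if $y=|\vee y'$ for some $y'$ and $\vdash$ otherwise; let $\circ^y_{n+1}$ be $\vdash$ if $y=y'\vee|$ for some $y'$ and $\dashv$ otherwise; and for $1\le i\le n$ let $\circ^y_i$ be $\dashv$ if the $i$th leaf is a left child and $\vdash$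 if it is a right child. For a representation $M$ of $D$ put $CY^n(D,M)=\mathrm{Hom}_K(K[Y_n]\otimes D^{\otimes n},M)$, with coboundary $$(\delta f)(y\otimes(a_1,\dots,a_{n+1}))=a_1\circ^y_0 f(d_0y\otimes(a_2,\dots,a_{n+1}))+\sum_{i=1}^n(-1)^if(d_iy\otimes(\dots,a_i\circ^y_ia_{i+1},\dots))+(-1)^{n+1}f(d_{n+1}y\otimes(a_1,\dots,a_n))\circ^y_{n+1}a_{n+1}.$$ Let $CY^n(\psi,\psi)=CY^n(D,D)\times CY^n(E,E)\times CY^{n-1}(D,E)$ (with $CY^{-1}=0$) and $\delta(\xi;\pi;\varphi)=(\delta\xi;\delta\pi;\psi\xi-\pi\psi-\delta\varphi)$, where $\psi\xi$ and $\pi\psi$ are obtained by composing values, respectively arguments in $D$, with $\psi$; let $HY^n(\psi,\psi)$ be the $n$th cohomology of $(CY^*(\psi,\psi),\delta)$. A deformation of $D$ is a pair of power series $\sum_{n\ge0}F^l_nt^n$, $\sum_{n\ge0}F^r_nt^n$ of bilinear maps $D\times D\to D$ with $F^l_0={\dashv}$, $F^r_0={\vdash}$, whose extensions to $D[[t]]$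 make $D[[t]]$ a dialgebra $D_t$; let $F_n\in CY^2(D,D)$ be given by $F_n([21]\otimes(a,b))=F^l_n(a,b)$ and $F_n([12]\otimes(a,b))=F^r_n(a,b)$. A deformation of $\psi$ consists of a deformation $\sum F_{D,n}t^n$ of $D$, a deformation $\sum F_{E,n}t^n$ of $E$, and a power series $\Psi_t=\sum_{n\ge0}\psi_nt^n$ of linear maps $\psi_n\colon D\to E$ with $\psi_0=\psi$, whose extension $D_t\to E_t$ is a dialgebra morphism. Its infinitesimal is the $2$-cochain $(F_{D,1};F_{E,1};\psi_1)\in CY^2(\psi,\psi)$. **Statement.** If $HY^3(\psi,\psi)=0$, then every $2$-cocycle in $CY^2(\psi,\psi)$ is the infinitesimal of some deformation of $\psi$. -/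

import Mathlib

namespace Dialg

/-! ### Dialgebras, morphisms, representations -/

section Basic

variable {K D E M : Type*} [Field K] [AddCommGroup D] [Module K D] [AddCommGroup E] [Module K E]
  [AddCommGroup M] [Module K M]

/-- The five dialgebra axioms for a left product `l` (written `⊣`) and a right product `r`
(written `⊢`). -/
structure IsDialgebra (l r : D →ₗ[K] D →ₗ[K] D) : Prop where
  ax1 : ∀ x y z, l x (l y z) = l (l x y) z
  ax2 : ∀ x y z, l (l x y) z = l x (r y z)
  ax3 : ∀ x y z, l (r x y) z = r x (l y z)
  ax4 : ∀ x y z, r (l x y) z = r x (r y z)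
  ax5 : ∀ x y z, r x (r y z) = r (r x y) z

/-- The two operation symbols `⊣` (`left`) and `⊢` (`right`). -/
inductive Side
  | left
  | right

end Basic

/-- A dialgebra structure over the field `K` on the `K`-module `D`. -/
structure Dialgebra (K D : Type*) [Field K] [AddCommGroup D] [Module K D] where
  /-- the left product `⊣` -/
  lprod : D →ₗ[K] D →ₗ[K] D
  /-- the right product `⊢` -/
  rprod : D →ₗ[K] D →ₗ[K] D
  isDialgebra : IsDialgebra lprod rprod

/-- The product named by a symbol. -/
def Dialgebra.op {K D : Type*} [Field K] [AddCommGroup D] [Module K D] (A : Dialgebra K D) :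
    Side → D →ₗ[K] D →ₗ[K] D
  | .left => A.lprod
  | .right => A.rprod

/-- A linear map respects the left and the right products of two dialgebras. -/
structure IsMorphism {K D E : Type*} [Field K] [AddCommGroup D] [Module K D] [AddCommGroup E]
    [Module K E] (A : Dialgebra K D) (B : Dialgebra K E) (g : D →ₗ[K] E) : Prop where
  map_lprod : ∀ x y, g (A.lprod x y) = B.lprod (g x) (g y)
  map_rprod : ∀ x y, g (A.rprod x y) = B.rprod (g x) (g y)

/-- Dialgebra morphisms. -/
structure Morphism {K D E : Type*} [Field K] [AddCommGroup D] [Module K D] [AddCommGroup E]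
    [Module K E] (A : Dialgebra K D) (B : Dialgebra K E) where
  toLinearMap : D →ₗ[K] E
  isMorphism : IsMorphism A B toLinearMap

/-- A representation `M` of a dialgebra: two left actions `ll` (`x ⊣ m`), `lr` (`x ⊢ m`) and two
right actions `rl` (`m ⊣ x`), `rr` (`m ⊢ x`), with the fifteen axioms obtained from the five
dialgebra axioms by taking exactly one of `x, y, z` in `M`. In `axiₖ`, the index `k` tells
which one of the three arguments lies in `M`. -/
structure Representation {K D : Type*} [Field K] [AddCommGroup D] [Module K D]
    (A : Dialgebra K D) (M : Type*) [AddCommGroup M] [Module K M] where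
  ll : D →ₗ[K] M →ₗ[K] M
  lr : D →ₗ[K] M →ₗ[K] M
  rl : M →ₗ[K] D →ₗ[K] M
  rr : M →ₗ[K] D →ₗ[K] M
  ax1₁ : ∀ m y z, rl m (A.lprod y z) = rl (rl m y) z
  ax1₂ : ∀ x m z, ll x (rl m z) = rl (ll x m) z
  ax1₃ : ∀ x y m, ll x (ll y m) = ll (A.lprod x y) m
  ax2₁ : ∀ m y z, rl (rl m y) z = rl m (A.rprod y z)
  ax2₂ : ∀ x m z, rl (ll x m) z = ll x (rr m z)
  ax2₃ : ∀ x y m, ll (A.lprod x y) m = ll x (lr y m)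
  ax3₁ : ∀ m y z, rl (rr m y) z = rr m (A.lprod y z)
  ax3₂ : ∀ x m z, rl (lr x m) z = lr x (rl m z)
  ax3₃ : ∀ x y m, ll (A.rprod x y) m = lr x (ll y m)
  ax4₁ : ∀ m y z, rr (rl m y) z = rr m (A.rprod y z)
  ax4₂ : ∀ x m z, rr (ll x m) z = lr x (rr m z)
  ax4₃ : ∀ x y m, lr (A.lprod x y) m = lr x (lr y m)
  ax5₁ : ∀ m y z, rr m (A.rprod y z) = rr (rr m y) z
  ax5₂ : ∀ x m z, lr x (rr m z) = rr (lr x m) z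
  ax5₃ : ∀ x y m, lr x (lr y m) = lr (A.rprod x y) m

/-- The left action named by a symbol. -/
def Representation.lact {K D M : Type*} [Field K] [AddCommGroup D] [Module K D] [AddCommGroup M]
    [Module K M] {A : Dialgebra K D} (R : Representation A M) : Side → D →ₗ[K] M →ₗ[K] M
  | .left => R.ll
  | .right => R.lr

/-- The right action named by a symbol. -/
def Representation.ract {K D M : Type*} [Field K] [AddCommGroup D] [Module K D] [AddCommGroup M]
    [Module K M] {A : Dialgebra K D} (R : Representation A M) : Side → M →ₗ[K] D →ₗ[K] M
  | .left => R.rl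
  | .right => R.rr

/-- A dialgebra as a representation of itself. -/
def Dialgebra.selfRep {K D : Type*} [Field K] [AddCommGroup D] [Module K D] (A : Dialgebra K D) :
    Representation A D where
  ll := A.lprod
  lr := A.rprod
  rl := A.lprod
  rr := A.rprod
  ax1₁ := A.isDialgebra.ax1
  ax1₂ := A.isDialgebra.ax1
  ax1₃ := A.isDialgebra.ax1
  ax2₁ := A.isDialgebra.ax2
  ax2₂ := A.isDialgebra.ax2
  ax2₃ := A.isDialgebra.ax2
  ax3₁ := A.isDialgebra.ax3
  ax3₂ := A.isDialgebra.ax3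
  ax3₃ := A.isDialgebra.ax3
  ax4₁ := A.isDialgebra.ax4
  ax4₂ := A.isDialgebra.ax4
  ax4₃ := A.isDialgebra.ax4
  ax5₁ := A.isDialgebra.ax5
  ax5₂ := A.isDialgebra.ax5
  ax5₃ := A.isDialgebra.ax5

/-- The target `E` of a morphism `ψ : D → E` as a representation of `D`:
`x * e = ψ x * e` and `e * x = e * ψ x` for both products. -/
def Morphism.rep {K D E : Type*} [Field K] [AddCommGroup D] [Module K D] [AddCommGroup E]
    [Module K E] {A : Dialgebra K D} {B : Dialgebra K E} (ψ : Morphism A B) :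
    Representation A E where
  ll := B.lprod.comp ψ.toLinearMap
  lr := B.rprod.comp ψ.toLinearMap
  rl := B.lprod.compl₂ ψ.toLinearMap
  rr := B.rprod.compl₂ ψ.toLinearMap
  ax1₁ m y z := by simp [ψ.isMorphism.map_lprod, B.isDialgebra.ax1]
  ax1₂ x m z := by simp [B.isDialgebra.ax1]
  ax1₃ x y m := by simp [ψ.isMorphism.map_lprod, B.isDialgebra.ax1]
  ax2₁ m y z := by simp [ψ.isMorphism.map_rprod, B.isDialgebra.ax2]
  ax2₂ x m z := by simp [B.isDialgebra.ax2]
  ax2₃ x y m := by simp [ψ.isMorphism.map_lprod, B.isDialgebra.ax2]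
  ax3₁ m y z := by simp [ψ.isMorphism.map_lprod, B.isDialgebra.ax3]
  ax3₂ x m z := by simp [B.isDialgebra.ax3]
  ax3₃ x y m := by simp [ψ.isMorphism.map_rprod, B.isDialgebra.ax3]
  ax4₁ m y z := by simp [ψ.isMorphism.map_rprod, B.isDialgebra.ax4]
  ax4₂ x m z := by simp [B.isDialgebra.ax4]
  ax4₃ x y m := by simp [ψ.isMorphism.map_lprod, B.isDialgebra.ax4]
  ax5₁ m y z := by simp [ψ.isMorphism.map_rprod, B.isDialgebra.ax5]
  ax5₂ x m z := by simp [B.isDialgebra.ax5]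
  ax5₃ x y m := by simp [ψ.isMorphism.map_rprod, B.isDialgebra.ax5]

/-! ### Planar binary trees

A planar binary tree is a `BinaryTree Unit`: `nil` is the tree `|` with one leaf and no internal
vertex, and `node () a b` is the grafting `a ∨ b`. A tree with `n` internal vertices has `n + 1`
leaves, numbered `0, …, n` from left to right. -/

/-- Planar binary trees with `n + 1` leaves. -/
abbrev Y (n : ℕ) : Type := {t : BinaryTree Unit // t.numNodes = n}

/-- Delete the `i`-th leaf of a tree, contracting the vertex below it (the tree `|` is returned
unchanged). -/
def deleteLeaf : BinaryTree Unit → ℕ → BinaryTree Unit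
  | .nil, _ => .nil
  | .node _ a b, i =>
    if i ≤ a.numNodes then
      (if a = .nil then b else .node () (deleteLeaf a i) b)
    else
      (if b = .nil then a else .node () a (deleteLeaf b (i - (a.numNodes + 1))))

theorem numNodes_deleteLeaf (t : BinaryTree Unit) (i n : ℕ) (hi : i ≤ n + 1)
    (ht : t.numNodes = n + 1) : (deleteLeaf t i).numNodes = n := by
  induction t generalizing i n with
  | nil => simp at ht
  | node u a b iha ihb =>
    have h0 : ∀ c : BinaryTree Unit, c ≠ .nil → 0 < c.numNodes := by
      intro c hc
      cases c with
      | nil => exact absurd rfl hc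
      | node u p q => simp
    simp only [BinaryTree.numNodes] at ht
    unfold deleteLeaf
    by_cases h : i ≤ a.numNodes
    · rw [if_pos h]
      by_cases ha : a = .nil
      · subst ha
        simp at ht ⊢
        exact ht
      · have hp := h0 a ha
        have := iha i (a.numNodes - 1) (by omega) (by omega)
        rw [if_neg ha, BinaryTree.numNodes, this]
        omega
    · rw [if_neg h]
      by_cases hb : b = .nil
      · subst hb
        simp at ht ⊢
        exact ht
      · have hp := h0 b hb
        have := ihb (i - (a.numNodes + 1)) (b.numNodes - 1) (by omega) (by omega)
        rw [if_neg hb, BinaryTree.numNodes, this]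
        omega

/-- The face map `d_i : Y_{n+1} → Y_n`, `0 ≤ i ≤ n + 1`, deleting the `i`-th leaf. -/
def d {n : ℕ} (i : Fin (n + 2)) (y : Y (n + 1)) : Y n :=
  ⟨deleteLeaf y.1 i, numNodes_deleteLeaf y.1 i n (by omega) y.2⟩

/-- The orientation of the `i`-th leaf: `⊣` if it is a left child (it points to the left, like
`\`), `⊢` if it is a right child (it points to the right, like `/`). The value for the tree `|` is
irrelevant. -/
def leafSide : BinaryTree Unit → ℕ → Side
  | .nil, _ => .left
  | .node _ a b, i =>
    if i ≤ a.numNodes then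
      (if a = .nil then .left else leafSide a i)
    else
      (if b = .nil then .right else leafSide b (i - (a.numNodes + 1)))

/-- The symbol `∘_0^y`: it is `⊣` if `y = | ∨ y'` for some `y'`, and `⊢` otherwise. -/
def firstSide : BinaryTree Unit → Side
  | .node _ .nil _ => .left
  | _ => .right

/-- The symbol `∘_{n+1}^y`, `y ∈ Y_{n+1}`: it is `⊢` if `y = y' ∨ |` for some `y'`, and `⊣`
otherwise. -/
def lastSide : BinaryTree Unit → Side
  | .node _ _ .nil => .right
  | _ => .left

/-- The tree `[21] = | ∨ (| ∨ |)`. -/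
def t21 : Y 2 := ⟨.node () .nil (.node () .nil .nil), rfl⟩

/-- The tree `[12] = (| ∨ |) ∨ |`. -/
def t12 : Y 2 := ⟨.node () (.node () .nil .nil) .nil, rfl⟩

/-! ### The dialgebra cochain complex -/

/-- The module `CY^n(D, M) = Hom(K[Y_n] ⊗ D^{⊗ n}, M)`: a linear map on `K[Y_n] ⊗ D^{⊗ n}` is the
same thing as a family of `n`-linear maps indexed by `Y_n`. -/
abbrev CY (K D M : Type*) [Field K] [AddCommGroup D] [Module K D] [AddCommGroup M] [Module K M]
    (n : ℕ) : Type _ :=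
  Y n → MultilinearMap K (fun _ : Fin n => D) M

section Coboundary

variable {K D M : Type*} [Field K] [AddCommGroup D] [Module K D] [AddCommGroup M] [Module K M]

theorem contractNth_update_ne {D : Type*} {n : ℕ} [DecidableEq (Fin (n + 1))] (j : Fin n)
    (op : D → D → D)
    (a : Fin (n + 1) → D) (m : Fin (n + 1)) (x : D) (k : Fin n) (hk : k ≠ j.predAbove m) :
    Fin.contractNth j.castSucc op (Function.update a m x) k = Fin.contractNth j.castSucc op a k := by
  have hk' : (k : ℕ) ≠ (j.predAbove m : ℕ) := fun h => hk (Fin.ext h)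
  have hval : (j.predAbove m : ℕ) = if (j : ℕ) < m then (m : ℕ) - 1 else m := by
    by_cases h : j.castSucc < m
    · rw [Fin.predAbove_of_castSucc_lt _ _ h, if_pos (by simpa [Fin.lt_def] using h)]
      simp
    · rw [Fin.predAbove_of_le_castSucc _ _ (not_lt.1 h),
        if_neg (by simpa [Fin.lt_def] using h)]
      simp
  rw [hval] at hk'
  have hm1 : ∀ i : Fin (n + 1), (i : ℕ) ≠ m → Function.update a m x i = a i := fun i hi =>
    Function.update_of_ne (fun h => hi (congrArg Fin.val h)) _ _
  unfold Fin.contractNth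
  simp only [Fin.val_castSucc]
  split_ifs with h1 h2
  · apply hm1
    simp only [Fin.val_castSucc]
    split_ifs at hk' <;> omega
  · rw [hm1, hm1]
    · simp only [Fin.val_succ]
      split_ifs at hk' <;> omega
    · simp only [Fin.val_castSucc]
      split_ifs at hk' <;> omega
  · apply hm1
    simp only [Fin.val_succ]
    split_ifs at hk' <;> omega

theorem contractNth_update {D : Type*} {n : ℕ} [DecidableEq (Fin (n + 1))] (j : Fin n)
    (op : D → D → D)
    (a : Fin (n + 1) → D) (m : Fin (n + 1)) (x : D) :
    Fin.contractNth j.castSucc op (Function.update a m x) =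
      Function.update (Fin.contractNth j.castSucc op a) (j.predAbove m)
        (Fin.contractNth j.castSucc op (Function.update a m x) (j.predAbove m)) := by
  funext k
  by_cases hk : k = j.predAbove m
  · subst hk
    simp
  · rw [Function.update_of_ne hk, contractNth_update_ne j op a m x k hk]

/-- The value of a contraction in the slot that contains the `m`-th variable is linear in it. -/
theorem contractNth_update_linear {n : ℕ} [DecidableEq (Fin (n + 1))] (j : Fin n)
    (op : D →ₗ[K] D →ₗ[K] D) (a : Fin (n + 1) → D) (m : Fin (n + 1)) :
    ∃ L : D →ₗ[K] D, ∀ x, Fin.contractNth j.castSucc (fun u v => op u v)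
      (Function.update a m x) (j.predAbove m) = L x := by
  rcases lt_trichotomy (m : ℕ) j with h | h | h
  · refine ⟨LinearMap.id, fun x => ?_⟩
    have hle : m ≤ j.castSucc := by simp [Fin.le_def]; omega
    have hv : ((j.predAbove m : Fin n) : ℕ) = m := by
      rw [Fin.predAbove_of_le_castSucc _ _ hle]; simp
    rw [Fin.contractNth_apply_of_lt _ _ _ _ (by simp [hv, h])]
    have : (j.predAbove m).castSucc = m := Fin.ext (by simp [hv])
    rw [this]; simp
  · refine ⟨op.flip (a j.succ), fun x => ?_⟩
    have hm : m = j.castSucc := Fin.ext (by simp [h])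
    have hv : j.predAbove m = j := by subst hm; simp
    rw [hv, Fin.contractNth_apply_of_eq _ _ _ _ (by simp), hm]
    rw [Function.update_self, Function.update_of_ne (by
      intro h'; have := congrArg Fin.val h'; simp at this)]
    simp
  · by_cases h' : (m : ℕ) = j + 1
    · refine ⟨op (a j.castSucc), fun x => ?_⟩
      have hm : m = j.succ := Fin.ext (by simp [h'])
      have hv : j.predAbove m = j := by subst hm; simp
      rw [hv, Fin.contractNth_apply_of_eq _ _ _ _ (by simp), hm]
      rw [Function.update_self, Function.update_of_ne (by
        intro h'; have := congrArg Fin.val h'; simp at this)]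
    · refine ⟨LinearMap.id, fun x => ?_⟩
      have hlt : j.castSucc < m := by simp [Fin.lt_def]; omega
      have hv : ((j.predAbove m : Fin n) : ℕ) = m - 1 := by
        rw [Fin.predAbove_of_castSucc_lt _ _ hlt]; simp
      rw [Fin.contractNth_apply_of_gt _ _ _ _ (by simp [hv]; omega)]
      have : (j.predAbove m).succ = m := Fin.ext (by simp [hv]; omega)
      rw [this]; simp

/-- The multilinear map `(a_1, …, a_{n+1}) ↦ g (…, a_{i-1}, a_i ∘ a_{i+1}, a_{i+2}, …)`, where
`i = j + 1`. -/
def contract {n : ℕ} (j : Fin n) (op : D →ₗ[K] D →ₗ[K] D)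
    (g : MultilinearMap K (fun _ : Fin n => D) M) :
    MultilinearMap K (fun _ : Fin (n + 1) => D) M where
  toFun a := g (Fin.contractNth j.castSucc (fun u v => op u v) a)
  map_update_add' a m x y := by
    obtain ⟨L, hL⟩ := contractNth_update_linear j op a m
    rw [contractNth_update j _ a m, contractNth_update j _ a m x, contractNth_update j _ a m y,
      hL, hL, hL, map_add, g.map_update_add]
  map_update_smul' a m c x := by
    obtain ⟨L, hL⟩ := contractNth_update_linear j op a m
    rw [contractNth_update j _ a m, contractNth_update j _ a m x,
      hL, hL, map_smul, g.map_update_smul]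

variable {A : Dialgebra K D}

/-- `δ^0 f`, i.e. `a_1 ∘_0^y f (d_0 y ⊗ (a_2, …, a_{n+1}))`. -/
def cofaceFirst (R : Representation A M) {n : ℕ} (f : CY K D M n) : CY K D M (n + 1) := fun y =>
  LinearMap.uncurryLeft (M := fun _ : Fin (n + 1) => D)
    { toFun := fun x => (R.lact (firstSide y.1) x).compMultilinearMap (f (d 0 y))
      map_add' := fun x x' => by ext; simp
      map_smul' := fun c x => by ext; simp }

/-- `δ^i f`, `1 ≤ i ≤ n`, i.e. `f (d_i y ⊗ (…, a_i ∘_i^y a_{i+1}, …))`, where `i = j + 1`. -/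
def cofaceMid {n : ℕ} (A : Dialgebra K D) (j : Fin n) (f : CY K D M n) : CY K D M (n + 1) :=
  fun y => contract j (A.op (leafSide y.1 (j + 1))) (f (d j.succ.castSucc y))

/-- `δ^{n+1} f`, i.e. `f (d_{n+1} y ⊗ (a_1, …, a_n)) ∘_{n+1}^y a_{n+1}`. -/
def cofaceLast (R : Representation A M) {n : ℕ} (f : CY K D M n) : CY K D M (n + 1) := fun y =>
  MultilinearMap.uncurryRight (M := fun _ : Fin (n + 1) => D)
    ((R.ract (lastSide y.1)).compMultilinearMap (f (d (Fin.last (n + 1)) y)))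

theorem cofaceFirst_apply (R : Representation A M) {n : ℕ} (f : CY K D M n) (y : Y (n + 1))
    (a : Fin (n + 1) → D) :
    cofaceFirst R f y a = R.lact (firstSide y.1) (a 0) (f (d 0 y) fun k => a k.succ) := rfl

theorem cofaceMid_apply {n : ℕ} (A : Dialgebra K D) (j : Fin n) (f : CY K D M n) (y : Y (n + 1))
    (a : Fin (n + 1) → D) :
    cofaceMid A j f y a = f (d j.succ.castSucc y)
      (Fin.contractNth j.castSucc (fun u v => A.op (leafSide y.1 (j + 1)) u v) a) := rfl

theorem cofaceLast_apply (R : Representation A M) {n : ℕ} (f : CY K D M n) (y : Y (n + 1))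
    (a : Fin (n + 1) → D) :
    cofaceLast R f y a = R.ract (lastSide y.1)
      (f (d (Fin.last (n + 1)) y) fun k => a k.castSucc) (a (Fin.last n)) := rfl

/-- The coboundary `δ = ∑_{i=0}^{n+1} (-1)^i δ^i : CY^n(D, M) → CY^{n+1}(D, M)`. -/
def coboundary (R : Representation A M) (n : ℕ) : CY K D M n →ₗ[K] CY K D M (n + 1) where
  toFun f := cofaceFirst R f + ∑ j : Fin n, (-1 : K) ^ ((j : ℕ) + 1) • cofaceMid A j f
    + (-1 : K) ^ (n + 1) • cofaceLast R f
  map_add' f g := by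
    ext y a
    simp [cofaceFirst_apply, cofaceMid_apply, cofaceLast_apply, Finset.sum_add_distrib]
    abel
  map_smul' c f := by
    ext y a
    simp [cofaceFirst_apply, cofaceMid_apply, cofaceLast_apply, Finset.smul_sum, smul_comm c]

end Coboundary

/-! ### The deformation complex of a dialgebra morphism -/

section DeformationComplex

/-- `CY^{n-1}(D, M)`, which is `0` for `n = 0`. -/
def CYpred (K D M : Type*) [Field K] [AddCommGroup D] [Module K D] [AddCommGroup M] [Module K M] :
    ℕ → Type _
  | 0 => PUnit
  | n + 1 => CY K D M n

instance CYpred.addCommGroup (K D M : Type*) [Field K] [AddCommGroup D] [Module K D]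
    [AddCommGroup M] [Module K M] : (n : ℕ) → AddCommGroup (CYpred K D M n)
  | 0 => (inferInstance : AddCommGroup PUnit)
  | n + 1 => (inferInstance : AddCommGroup (CY K D M n))

instance CYpred.module.{u, v, w} (K : Type u) (D : Type v) (M : Type w) [Field K]
    [AddCommGroup D] [Module K D] [AddCommGroup M] [Module K M] :
    (n : ℕ) → Module K (CYpred K D M n)
  | 0 => (inferInstance : Module K PUnit.{(max v w) + 1})
  | n + 1 => (inferInstance : Module K (CY K D M n))

variable {K D E : Type*} [Field K] [AddCommGroup D] [Module K D] [AddCommGroup E] [Module K E]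
  {A : Dialgebra K D} {B : Dialgebra K E}

/-- The coboundary `CY^{n-1}(D, M) → CY^n(D, M)`, which is `0` for `n = 0`. -/
def coboundaryPred {M : Type*} [AddCommGroup M] [Module K M] (R : Representation A M) :
    (n : ℕ) → CYpred K D M n →ₗ[K] CY K D M n
  | 0 => 0
  | n + 1 => coboundary R n

/-- The push-forward `ψ ξ` of `ξ ∈ CY^n(D, D)`. -/
def push (ψ : Morphism A B) (n : ℕ) : CY K D D n →ₗ[K] CY K D E n where
  toFun ξ := fun y => ψ.toLinearMap.compMultilinearMap (ξ y)
  map_add' ξ ξ' := by ext; simp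
  map_smul' c ξ := by ext; simp

/-- The pull-back `π ψ` of `π ∈ CY^n(E, E)`. -/
def pull (ψ : Morphism A B) (n : ℕ) : CY K E E n →ₗ[K] CY K D E n where
  toFun π := fun y => (π y).compLinearMap fun _ => ψ.toLinearMap
  map_add' π π' := by ext; simp
  map_smul' c π := by ext; simp

/-- The module `CY^n(ψ, ψ) = CY^n(D, D) × CY^n(E, E) × CY^{n-1}(D, E)`. -/
abbrev DefCochain (_ψ : Morphism A B) (n : ℕ) : Type _ :=
  CY K D D n × CY K E E n × CYpred K D E n

/-- The coboundary `δ (ξ; π; φ) = (δ ξ; δ π; ψ ξ - π ψ - δ φ)` of the deformation complex. -/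
def defCoboundary (ψ : Morphism A B) (n : ℕ) : DefCochain ψ n →ₗ[K] DefCochain ψ (n + 1) where
  toFun c := (coboundary A.selfRep n c.1, coboundary B.selfRep n c.2.1,
    (push ψ n c.1 - pull ψ n c.2.1 - coboundaryPred ψ.rep n c.2.2 : CY K D E n))
  map_add' c c' := by
    refine Prod.ext (by simp) (Prod.ext (by simp) ?_)
    change (_ : CY K D E n) = (_ : CY K D E n) + (_ : CY K D E n)
    simp only [Prod.fst_add, Prod.snd_add, map_add]
    abel
  map_smul' r c := by
    refine Prod.ext (by simp) (Prod.ext (by simp) ?_)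
    change (_ : CY K D E n) = r • (_ : CY K D E n)
    simp only [Prod.smul_fst, Prod.smul_snd, map_smul, smul_sub]

/-- The `n`-cocycles of the deformation complex. -/
def cocycles (ψ : Morphism A B) (n : ℕ) : Submodule K (DefCochain ψ n) :=
  LinearMap.ker (defCoboundary ψ n)

/-- The `n`-coboundaries of the deformation complex. -/
def coboundaries (ψ : Morphism A B) : (n : ℕ) → Submodule K (DefCochain ψ n)
  | 0 => ⊥
  | n + 1 => LinearMap.range (defCoboundary ψ n)

/-- The cohomology `HY^n(ψ, ψ)` of the deformation complex. -/
abbrev HY (ψ : Morphism A B) (n : ℕ) : Type _ :=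
  cocycles ψ n ⧸ (coboundaries ψ n).submoduleOf (cocycles ψ n)

end DeformationComplex

/-! ### Formal deformations -/

section Deformation

variable {K D E : Type*} [Field K] [AddCommGroup D] [Module K D] [AddCommGroup E] [Module K E]

/-- The `K`-module `D⟦t⟧` of formal power series `∑ x_n t^n` with coefficients in `D`. -/
abbrev Series (D : Type*) : Type _ := ℕ → D

/-- The extension of a power series `∑ F_n t^n` of bilinear maps to `D⟦t⟧`: the coefficient of
`t^n` in the product of `∑ x_j t^j` and `∑ y_k t^k` is `∑_{i+j+k=n} F_i (x_j, y_k)`. -/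
def extendBilin (F : ℕ → D →ₗ[K] D →ₗ[K] D) :
    Series D →ₗ[K] Series D →ₗ[K] Series D :=
  LinearMap.mk₂ K
    (fun x y n => ∑ p ∈ Finset.HasAntidiagonal.antidiagonal n, ∑ q ∈ Finset.HasAntidiagonal.antidiagonal p.2,
      F p.1 (x q.1) (y q.2))
    (fun x x' y => by funext n; simp [Finset.sum_add_distrib])
    (fun c x y => by funext n; simp [Finset.smul_sum])
    (fun x y y' => by funext n; simp [Finset.sum_add_distrib])
    (fun c x y => by funext n; simp [Finset.smul_sum])

/-- The extension of a power series `∑ g_n t^n` of linear maps to `D⟦t⟧ → E⟦t⟧`. -/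
def extendLin (g : ℕ → D →ₗ[K] E) : Series D →ₗ[K] Series E where
  toFun x := fun n => ∑ p ∈ Finset.HasAntidiagonal.antidiagonal n, g p.1 (x p.2)
  map_add' x y := by funext n; simp [Finset.sum_add_distrib]
  map_smul' c x := by funext n; simp [Finset.smul_sum]

/-- A deformation of the dialgebra structure `A` on `D`. -/
structure Deformation (A : Dialgebra K D) where
  Fl : ℕ → D →ₗ[K] D →ₗ[K] D
  Fr : ℕ → D →ₗ[K] D →ₗ[K] D
  Fl_zero : Fl 0 = A.lprod
  Fr_zero : Fr 0 = A.rprod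
  isDialgebra : IsDialgebra (extendBilin Fl) (extendBilin Fr)

/-- The dialgebra `D_t` of a deformation, on `D⟦t⟧`. -/
def Deformation.total {A : Dialgebra K D} (f : Deformation A) : Dialgebra K (Series D) :=
  ⟨extendBilin f.Fl, extendBilin f.Fr, f.isDialgebra⟩

/-- A bilinear map as a multilinear map on `Fin 2`. -/
def bilinToMultilin (F : D →ₗ[K] D →ₗ[K] E) : MultilinearMap K (fun _ : Fin 2 => D) E :=
  MultilinearMap.mk' (fun a => F (a 0) (a 1))
    (fun a i x y => by fin_cases i <;> simp)
    (fun a i c x => by fin_cases i <;> simp)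

/-- The `2`-cochain `F_n`, with `F_n ([21] ⊗ (a, b)) = F^l_n (a, b)` and
`F_n ([12] ⊗ (a, b)) = F^r_n (a, b)`. -/
def Deformation.cochain {A : Dialgebra K D} (f : Deformation A) (n : ℕ) : CY K D D 2 :=
  fun y => if y = t21 then bilinToMultilin (f.Fl n) else bilinToMultilin (f.Fr n)

/-- A linear map `D → E` as a `1`-cochain (there is exactly one tree in `Y_1`). -/
def oneCochain (g : D →ₗ[K] E) : CY K D E 1 :=
  fun _ => MultilinearMap.ofSubsingleton K D E 0 g

/-- A deformation `Θ_t = (f_{D,t}; f_{E,t}; Ψ_t)` of the dialgebra morphism `ψ`. -/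
structure MorphismDeformation {A : Dialgebra K D} {B : Dialgebra K E} (ψ : Morphism A B) where
  fD : Deformation A
  fE : Deformation B
  map : ℕ → D →ₗ[K] E
  map_zero : map 0 = ψ.toLinearMap
  isMorphism : IsMorphism fD.total fE.total (extendLin map)

/-- The coefficient `θ_n = (F_{D,n}; F_{E,n}; ψ_n) ∈ CY^2(ψ, ψ)` of a deformation of `ψ`. -/
def MorphismDeformation.coeff {A : Dialgebra K D} {B : Dialgebra K E} {ψ : Morphism A B}
    (Θ : MorphismDeformation ψ) (n : ℕ) : DefCochain ψ 2 :=
  (Θ.fD.cochain n, Θ.fE.cochain n, oneCochain (Θ.map n))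

/-- The infinitesimal `θ_1` of a deformation of `ψ`. -/
def MorphismDeformation.infinitesimal {A : Dialgebra K D} {B : Dialgebra K E} {ψ : Morphism A B}
    (Θ : MorphismDeformation ψ) : DefCochain ψ 2 :=
  Θ.coeff 1

end Deformation

end Dialg

/-! A deformation is built one power of `t` at a time, and the obstruction to each step is a
3-cocycle of the deformation complex.

The five dialgebra axioms correspond to the five trees of `Y 3`: each is the vanishing of an
associator whose operations are read off the faces of the tree. For two arbitrary bilinear
operations these associators satisfy a pentagon identity for each tree of `Y 4`
(`associator_identity`), and the failure of a linear map to be multiplicative satisfies a similar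
identity for each tree of `Y 3` (`morDefect_identity`). No axiom enters either of them.

Apply both identities to the operations on power series. If the associators and the defect vanish
below `t^N`, then in the coefficient of `t^N` the outer operations and the linear map contribute
only their undeformed terms. The identities then say that the triple formed by the two associators
and minus the defect is a cocycle (`obstruction_mem_cocycles`). Adding a 2-cochain `η` in degree `N
> 0` changes this triple by `-δη` (`obstruction_add_single`), since terms of higher order in `η`
only start beyond `t^N`. As the third cohomology vanishes, some `η` removes the obstruction.

The recursion starts at the given cocycle, whose degree-one obstruction is `-δ` of it, hence zero.
Later corrections never touch earlier coefficients, so the stages have a limit, and all its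
obstructions vanish. Since associators and defect are linear over power series, this vanishing on
constant arguments gives the axioms on all of `D⟦t⟧` and `E⟦t⟧` (`exists_deformation`). -/

namespace Dialg

/-! ### Formal identities for the associators of two arbitrary bilinear operations -/

/-! ### Enumeration of small trees. -/

section Trees

/-- The operation symbol attached to a tree in `Y_2`. -/
def treeSide (y : Y 2) : Side :=
  if y = t21 then .left else .right

theorem treeSide_t21 : treeSide t21 = .left := by simp [treeSide]

theorem t12_ne_t21 : t12 ≠ t21 := by decide

theorem treeSide_t12 : treeSide t12 = .right := by simp [treeSide, t12_ne_t21]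

theorem tree_cases_zero {t : BinaryTree Unit} (h : t.numNodes = 0) : t = .nil := by
  cases t with
  | nil => rfl
  | node u a b => simp [BinaryTree.numNodes] at h

theorem tree_cases_succ {t : BinaryTree Unit} {n : ℕ} (h : t.numNodes = n + 1) :
    ∃ a b, t = .node () a b ∧ a.numNodes + b.numNodes = n := by
  cases t with
  | nil => simp [BinaryTree.numNodes] at h
  | node u a b => exact ⟨a, b, rfl, by simpa [BinaryTree.numNodes] using h⟩

theorem tree_cases_one {t : BinaryTree Unit} (h : t.numNodes = 1) : t = .node () .nil .nil := by
  obtain ⟨a, b, rfl, h⟩ := tree_cases_succ h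
  rw [tree_cases_zero (t := a) (by omega), tree_cases_zero (t := b) (by omega)]

theorem tree_cases_two {t : BinaryTree Unit} (h : t.numNodes = 2) : t = t21.1 ∨ t = t12.1 := by
  obtain ⟨a, b, rfl, h⟩ := tree_cases_succ h
  obtain ha | ha : a.numNodes = 0 ∨ a.numNodes = 1 := by omega
  · rw [tree_cases_zero ha, tree_cases_one (t := b) (by omega)]
    exact .inl rfl
  · rw [tree_cases_one ha, tree_cases_zero (t := b) (by omega)]
    exact .inr rfl

theorem Y_two_cases (y : Y 2) : y = t21 ∨ y = t12 :=
  (tree_cases_two y.2).imp Subtype.ext Subtype.ext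

theorem tree_cases_three {t : BinaryTree Unit} (h : t.numNodes = 3) :
    t = .node () .nil t21.1 ∨ t = .node () .nil t12.1 ∨
      t = .node () (.node () .nil .nil) (.node () .nil .nil) ∨
      t = .node () t21.1 .nil ∨ t = .node () t12.1 .nil := by
  obtain ⟨a, b, rfl, h⟩ := tree_cases_succ h
  obtain ha | ha | ha : a.numNodes = 0 ∨ a.numNodes = 1 ∨ a.numNodes = 2 := by omega
  · rw [tree_cases_zero ha]
    rcases tree_cases_two (t := b) (by omega) with rfl | rfl <;> simp
  · rw [tree_cases_one ha, tree_cases_one (t := b) (by omega)]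
    simp
  · rw [tree_cases_zero (t := b) (by omega)]
    rcases tree_cases_two ha with rfl | rfl <;> simp

end Trees

/-! ### Associators and defects indexed by trees. -/

section Identities

variable {K V W : Type*} [Field K] [AddCommGroup V] [Module K V] [AddCommGroup W] [Module K W]

/-- The associator attached to a tree in `Y_3`; its vanishing is one of the dialgebra axioms. -/
def associator (P : Side → V →ₗ[K] V →ₗ[K] V) (y : Y 3) (a b c : V) : V :=
  P (treeSide (d 1 y)) (P (treeSide (d 3 y)) a b) c
    - P (treeSide (d 2 y)) a (P (treeSide (d 0 y)) b c)

/-- The failure of `g` to respect the operation attached to a tree in `Y_2`. -/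
def morDefect (P : Side → V →ₗ[K] V →ₗ[K] V) (Q : Side → W →ₗ[K] W →ₗ[K] W) (g : V →ₗ[K] W)
    (y : Y 2) (a b : V) : W :=
  g (P (treeSide y) a b) - Q (treeSide y) (g a) (g b)

/-- Bridges two descriptions: the coboundary reads its symbols from leaves, while `associator` reads
them from faces. With both matched, the coboundary of a 2-cochain is, up to sign, the linearised
associator. -/
theorem sides_three (y : Y 3) :
    firstSide y.1 = treeSide (d 2 y) ∧ leafSide y.1 1 = treeSide (d 3 y) ∧
      leafSide y.1 2 = treeSide (d 0 y) ∧ lastSide y.1 = treeSide (d 1 y) := by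
  obtain ⟨t, ht⟩ := y
  rcases tree_cases_three ht with rfl | rfl | rfl | rfl | rfl <;> exact ⟨rfl, rfl, rfl, rfl⟩

/-- Splitting by the size of the left subtree reduces the fourteen trees to 5 + 2 + 2 + 5 explicit
ones. -/
theorem tree_cases_four {p : Y 4 → Prop} (h0 : ∀ b : Y 3, p ⟨.node () .nil b.1, by simp [b.2]⟩)
    (h1 : ∀ b : Y 2, p ⟨.node () (.node () .nil .nil) b.1, by simp [b.2]⟩)
    (h2 : ∀ a : Y 2, p ⟨.node () a.1 (.node () .nil .nil), by simp [a.2]⟩)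
    (h3 : ∀ a : Y 3, p ⟨.node () a.1 .nil, by simp [a.2]⟩) (y : Y 4) : p y := by
  obtain ⟨t, ht⟩ := y
  obtain ⟨a, b, rfl, h⟩ := tree_cases_succ ht
  obtain ha | ha | ha | ha :
    a.numNodes = 0 ∨ a.numNodes = 1 ∨ a.numNodes = 2 ∨ a.numNodes = 3 := by omega
  · obtain rfl := tree_cases_zero ha
    exact h0 ⟨b, by omega⟩
  · obtain rfl := tree_cases_one ha
    exact h1 ⟨b, by omega⟩
  · obtain rfl := tree_cases_one (t := b) (by omega)
    exact h2 ⟨a, ha⟩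
  · obtain rfl := tree_cases_zero (t := b) (by omega)
    exact h3 ⟨a, ha⟩

/-- The first two groups say, through `sides_three`, that an outer symbol or the orientation of an
inner leaf survives the listed deletions. The last group consists of the simplicial identities `d_i
d_j = d_{j-1} d_i` for `i < j - 1`, read through `treeSide`. Everything is decided by computation on
the fourteen trees. -/
theorem sides_four (y : Y 4) :
    (firstSide y.1 = treeSide (d 2 (d 2 y)) ∧ firstSide y.1 = treeSide (d 2 (d 3 y)) ∧
      lastSide y.1 = treeSide (d 1 (d 1 y)) ∧ lastSide y.1 = treeSide (d 1 (d 2 y))) ∧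
    (leafSide y.1 1 = treeSide (d 3 (d 4 y)) ∧ leafSide y.1 1 = treeSide (d 3 (d 3 y)) ∧
      leafSide y.1 2 = treeSide (d 3 (d 0 y)) ∧ leafSide y.1 2 = treeSide (d 0 (d 4 y)) ∧
      leafSide y.1 3 = treeSide (d 0 (d 0 y)) ∧ leafSide y.1 3 = treeSide (d 0 (d 1 y))) ∧
    (treeSide (d 1 (d 0 y)) = treeSide (d 0 (d 2 y)) ∧
      treeSide (d 2 (d 0 y)) = treeSide (d 0 (d 3 y)) ∧
      treeSide (d 3 (d 1 y)) = treeSide (d 1 (d 4 y)) ∧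
      treeSide (d 2 (d 1 y)) = treeSide (d 1 (d 3 y)) ∧
      treeSide (d 3 (d 2 y)) = treeSide (d 2 (d 4 y))) := by
  induction y using tree_cases_four with
  | h0 b =>
    obtain ⟨b, hb⟩ := b
    rcases tree_cases_three hb with rfl | rfl | rfl | rfl | rfl <;>
      exact ⟨⟨rfl, rfl, rfl, rfl⟩, ⟨rfl, rfl, rfl, rfl, rfl, rfl⟩, rfl, rfl, rfl, rfl, rfl⟩
  | h1 b =>
    rcases Y_two_cases b with rfl | rfl <;>
      exact ⟨⟨rfl, rfl, rfl, rfl⟩, ⟨rfl, rfl, rfl, rfl, rfl, rfl⟩, rfl, rfl, rfl, rfl, rfl⟩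
  | h2 a =>
    rcases Y_two_cases a with rfl | rfl <;>
      exact ⟨⟨rfl, rfl, rfl, rfl⟩, ⟨rfl, rfl, rfl, rfl, rfl, rfl⟩, rfl, rfl, rfl, rfl, rfl⟩
  | h3 a =>
    obtain ⟨a, ha⟩ := a
    rcases tree_cases_three ha with rfl | rfl | rfl | rfl | rfl <;>
      exact ⟨⟨rfl, rfl, rfl, rfl⟩, ⟨rfl, rfl, rfl, rfl, rfl, rfl⟩, rfl, rfl, rfl, rfl, rfl⟩

/-- The five trees, in the order of `tree_cases_three`, give the five axioms in their order. -/
theorem isDialgebra_iff (P : Side → V →ₗ[K] V →ₗ[K] V) :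
    IsDialgebra (P .left) (P .right) ↔ ∀ y a b c, associator P y a b c = 0 := by
  constructor
  · rintro ⟨h1, h2, h3, h4, h5⟩ ⟨t, ht⟩ a b c
    refine sub_eq_zero.2 ?_
    rcases tree_cases_three ht with rfl | rfl | rfl | rfl | rfl
    · exact (h1 a b c).symm
    · exact h2 a b c
    · exact h3 a b c
    · exact h4 a b c
    · exact (h5 a b c).symm
  · intro h
    refine ⟨fun a b c => ?_, fun a b c => ?_, fun a b c => ?_, fun a b c => ?_, fun a b c => ?_⟩
    · exact (sub_eq_zero.1 (h ⟨.node () .nil t21.1, rfl⟩ a b c)).symm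
    · exact sub_eq_zero.1 (h ⟨.node () .nil t12.1, rfl⟩ a b c)
    · exact sub_eq_zero.1 (h ⟨.node () (.node () .nil .nil) (.node () .nil .nil), rfl⟩ a b c)
    · exact sub_eq_zero.1 (h ⟨.node () t21.1 .nil, rfl⟩ a b c)
    · exact (sub_eq_zero.1 (h ⟨.node () t12.1 .nil, rfl⟩ a b c)).symm

/-- On the left the mixed terms `g a ∘ g (b ∘ c)` and `g (a ∘ b) ∘ g c` each occur twice with
opposite signs; what survives is the two associators. -/
theorem morDefect_identity (P : Side → V →ₗ[K] V →ₗ[K] V) (Q : Side → W →ₗ[K] W →ₗ[K] W)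
    (g : V →ₗ[K] W) (y : Y 3) (a b c : V) :
    Q (firstSide y.1) (g a) (morDefect P Q g (d 0 y) b c)
      - morDefect P Q g (d 1 y) (P (leafSide y.1 1) a b) c
      + morDefect P Q g (d 2 y) a (P (leafSide y.1 2) b c)
      - Q (lastSide y.1) (morDefect P Q g (d 3 y) a b) (g c)
      = associator Q y (g a) (g b) (g c) - g (associator P y a b c) := by
  obtain ⟨h0, h1, h2, h3⟩ := sides_three y
  simp only [morDefect, associator, h0, h1, h2, h3, map_sub, LinearMap.sub_apply]
  abel

/-- The pentagon: the five associators have ten terms, and each of the five bracketings of `a, b, c,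
e` occurs twice with opposite signs. `sides_four` ensures that the operations in the two occurrences
agree. -/
theorem associator_identity (P : Side → V →ₗ[K] V →ₗ[K] V) (y : Y 4) (a b c e : V) :
    P (firstSide y.1) a (associator P (d 0 y) b c e)
      - associator P (d 1 y) (P (leafSide y.1 1) a b) c e
      + associator P (d 2 y) a (P (leafSide y.1 2) b c) e
      - associator P (d 3 y) a b (P (leafSide y.1 3) c e)
      + P (lastSide y.1) (associator P (d 4 y) a b c) e = 0 := by
  obtain ⟨⟨f0, f1, l0, l1⟩, ⟨m0, m1, m2, m3, m4, m5⟩, h0, h1, h2, h3, h4⟩ := sides_four y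
  simp only [associator, map_sub, LinearMap.sub_apply, h0, h1, h2, h3, h4, ← f0, ← f1, ← l0, ← l1,
    ← m0, ← m1, ← m2, ← m3, ← m4, ← m5]
  abel

end Identities

/-! ### Leading coefficients of power series -/

section SeriesLemmas

variable {K V W : Type*} [Field K] [AddCommGroup V] [Module K V] [AddCommGroup W] [Module K W]

/-- The coefficients of `x` and `y` agree below `t^N`. -/
def AgreeBelow (N : ℕ) (x y : ℕ → V) : Prop := ∀ i < N, x i = y i

theorem extendBilin_apply (F : ℕ → V →ₗ[K] V →ₗ[K] V) (x y : Series V) (n : ℕ) :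
    extendBilin F x y n = ∑ p ∈ Finset.HasAntidiagonal.antidiagonal n,
      ∑ q ∈ Finset.HasAntidiagonal.antidiagonal p.2, F p.1 (x q.1) (y q.2) := rfl

theorem extendLin_apply (g : ℕ → V →ₗ[K] W) (x : Series V) (n : ℕ) :
    extendLin g x n = ∑ p ∈ Finset.HasAntidiagonal.antidiagonal n, g p.1 (x p.2) := rfl

theorem AgreeBelow.extendBilin {N : ℕ} {F G : ℕ → V →ₗ[K] V →ₗ[K] V} {x x' y y' : Series V}
    (hF : AgreeBelow N F G) (hx : AgreeBelow N x x') (hy : AgreeBelow N y y') :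
    AgreeBelow N (extendBilin F x y) (extendBilin G x' y') := by
  intro n hn
  simp only [extendBilin_apply]
  refine Finset.sum_congr rfl fun p hp => Finset.sum_congr rfl fun q hq => ?_
  rw [Finset.HasAntidiagonal.mem_antidiagonal] at hp hq
  rw [hF p.1 (by omega), hx q.1 (by omega), hy q.2 (by omega)]

theorem AgreeBelow.extendLin {N : ℕ} {g h : ℕ → V →ₗ[K] W} {x x' : Series V}
    (hg : AgreeBelow N g h) (hx : AgreeBelow N x x') :
    AgreeBelow N (extendLin g x) (extendLin h x') := by
  intro n hn
  simp only [extendLin_apply]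
  refine Finset.sum_congr rfl fun p hp => ?_
  rw [Finset.HasAntidiagonal.mem_antidiagonal] at hp
  rw [hg p.1 (by omega), hx p.2 (by omega)]

theorem sum_antidiagonal_single {N : ℕ} {f : ℕ × ℕ → V} (a b : ℕ) (hab : a + b = N)
    (h : ∀ i j, i + j = N → (i, j) ≠ (a, b) → f (i, j) = 0) :
    ∑ p ∈ Finset.HasAntidiagonal.antidiagonal N, f p = f (a, b) := by
  refine Finset.sum_eq_single (a, b) (fun p hp hne => ?_) fun hn => ?_
  · exact h p.1 p.2 (Finset.HasAntidiagonal.mem_antidiagonal.1 hp) hne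
  · exact absurd (Finset.HasAntidiagonal.mem_antidiagonal.2 hab) hn

/-- If `F`, `x`, `y` start in degrees `i`, `j`, `k`, then the first coefficient of the product is
the product of the first coefficients. -/
theorem extendBilin_leading {F : ℕ → V →ₗ[K] V →ₗ[K] V} {x y : Series V} (i j k : ℕ)
    (hF : AgreeBelow i F 0) (hx : AgreeBelow j x 0) (hy : AgreeBelow k y 0) :
    extendBilin F x y (i + j + k) = F i (x j) (y k) := by
  rw [extendBilin_apply, sum_antidiagonal_single i (j + k) (by omega),
    sum_antidiagonal_single j k rfl]
  · intro a b hab hne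
    obtain h | h : a < j ∨ b < k := by
      by_contra! h
      exact hne (Prod.ext (by simp; omega) (by simp; omega))
    · simp [hx a h]
    · simp [hy b h]
  · intro a b hab hne
    refine Finset.sum_eq_zero fun q hq => ?_
    rw [Finset.HasAntidiagonal.mem_antidiagonal] at hq
    simp only at hq ⊢
    obtain h | h | h : a < i ∨ q.1 < j ∨ q.2 < k := by
      by_contra! h
      exact hne (Prod.ext (by simp; omega) (by simp; omega))
    · simp [hF a h]
    · simp [hx _ h]
    · simp [hy _ h]

theorem extendBilin_below {F : ℕ → V →ₗ[K] V →ₗ[K] V} {x y : Series V} (i j k : ℕ)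
    (hF : AgreeBelow i F 0) (hx : AgreeBelow j x 0) (hy : AgreeBelow k y 0) :
    AgreeBelow (i + j + k) (extendBilin F x y) 0 := by
  intro n hn
  rw [extendBilin_apply]
  refine Finset.sum_eq_zero fun p hp => Finset.sum_eq_zero fun q hq => ?_
  rw [Finset.HasAntidiagonal.mem_antidiagonal] at hp hq
  obtain h | h | h : p.1 < i ∨ q.1 < j ∨ q.2 < k := by omega
  · simp [hF _ h]
  · simp [hx _ h]
  · simp [hy _ h]

theorem extendLin_leading {g : ℕ → V →ₗ[K] W} {x : Series V} (i j : ℕ)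
    (hg : AgreeBelow i g 0) (hx : AgreeBelow j x 0) :
    extendLin g x (i + j) = g i (x j) := by
  rw [extendLin_apply, sum_antidiagonal_single i j rfl]
  intro a b hab hne
  obtain h | h : a < i ∨ b < j := by
    by_contra! h
    exact hne (Prod.ext (by simp; omega) (by simp; omega))
  · simp [hg a h]
  · simp [hx b h]

theorem extendLin_below {g : ℕ → V →ₗ[K] W} {x : Series V} (i j : ℕ)
    (hg : AgreeBelow i g 0) (hx : AgreeBelow j x 0) :
    AgreeBelow (i + j) (extendLin g x) 0 := by
  intro n hn
  rw [extendLin_apply]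
  refine Finset.sum_eq_zero fun p hp => ?_
  rw [Finset.HasAntidiagonal.mem_antidiagonal] at hp
  obtain h | h : p.1 < i ∨ p.2 < j := by omega
  · simp [hg _ h]
  · simp [hx _ h]

/-! ### Linearity over power series and reduction to constant arguments. -/

theorem agreeBelow_zero {V : Type*} (x y : ℕ → V) : AgreeBelow 0 x y :=
  fun _ h => absurd h (Nat.not_lt_zero _)

/-- The constant power series. -/
def constSeries (a : V) : Series V := Pi.single 0 a

theorem constSeries_zero (a : V) : constSeries a 0 = a := Pi.single_eq_same _ _

/-- Multiplication of power series by `t`. -/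
def shift (x : Series V) : Series V
  | 0 => 0
  | n + 1 => x n

theorem eq_constSeries_add_shift (x : Series V) :
    x = constSeries (x 0) + shift fun n => x (n + 1) := by
  funext n
  cases n <;> simp [constSeries, shift]

theorem extendBilin_shift_left (F : ℕ → V →ₗ[K] V →ₗ[K] V) (x y : Series V) :
    extendBilin F (shift x) y = shift (extendBilin F x y) := by
  funext n
  cases n with
  | zero => simp [shift, extendBilin_apply]
  | succ n =>
    simp [shift, extendBilin_apply, Finset.Nat.sum_antidiagonal_succ' (n := n),
      Finset.Nat.sum_antidiagonal_succ]

theorem extendBilin_shift_right (F : ℕ → V →ₗ[K] V →ₗ[K] V) (x y : Series V) :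
    extendBilin F x (shift y) = shift (extendBilin F x y) := by
  funext n
  cases n with
  | zero => simp [shift, extendBilin_apply]
  | succ n => simp [shift, extendBilin_apply, Finset.Nat.sum_antidiagonal_succ']

theorem extendLin_shift (g : ℕ → V →ₗ[K] W) (x : Series V) :
    extendLin g (shift x) = shift (extendLin g x) := by
  funext n
  cases n with
  | zero => simp [shift, extendLin_apply]
  | succ n => simp [shift, extendLin_apply, Finset.Nat.sum_antidiagonal_succ']

theorem shift_sub (x y : Series V) : shift (x - y) = shift x - shift y := by
  funext n
  cases n <;> simp [shift]

/-- An operator on power series is additive and commutes with multiplication by `t`. -/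
structure ShiftAdditive (T : Series V → Series W) : Prop where
  map_add : ∀ x y, T (x + y) = T x + T y
  map_shift : ∀ x, T (shift x) = shift (T x)

/-- Write `x = x_0 + t x'`. Coefficient `n + 1` of `T x` is that of `T x_0` plus coefficient `n` of
`T x'`, so induction on the degree works for all `x` at once. -/
theorem ShiftAdditive.below {T : Series V → Series W} (hT : ShiftAdditive T) {N : ℕ}
    (h : ∀ a, AgreeBelow N (T (constSeries a)) 0) (x : Series V) : AgreeBelow N (T x) 0 := by
  intro n hn
  induction n generalizing x with
  | zero =>
    rw [eq_constSeries_add_shift x, hT.map_add, hT.map_shift, Pi.add_apply, h _ _ hn]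
    simp [shift]
  | succ n ih =>
    rw [eq_constSeries_add_shift x, hT.map_add, hT.map_shift, Pi.add_apply, h _ _ hn]
    simp [shift, ih _ (by omega)]

theorem ShiftAdditive.leading {T : Series V → Series W} (hT : ShiftAdditive T) {N : ℕ}
    (h : ∀ a, AgreeBelow N (T (constSeries a)) 0) (x : Series V) :
    T x N = T (constSeries (x 0)) N := by
  conv_lhs => rw [eq_constSeries_add_shift x, hT.map_add, hT.map_shift, Pi.add_apply]
  cases N with
  | zero => simp [shift]
  | succ n => simp [shift, hT.below h _ n (by omega)]

theorem ShiftAdditive.leading₂ {T : Series V → Series V → Series W}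
    (h₁ : ∀ y, ShiftAdditive fun x => T x y) (h₂ : ∀ x, ShiftAdditive fun y => T x y) {N : ℕ}
    (h : ∀ a b, AgreeBelow N (T (constSeries a) (constSeries b)) 0) (x y : Series V) :
    AgreeBelow N (T x y) 0 ∧ T x y N = T (constSeries (x 0)) (constSeries (y 0)) N := by
  have h' : ∀ y a, AgreeBelow N (T (constSeries a) y) 0 := fun y a => (h₂ _).below (h a) y
  exact ⟨(h₁ y).below (h' y) x,
    ((h₁ y).leading (h' y) x).trans ((h₂ _).leading (h _) y)⟩

theorem ShiftAdditive.leading₃ {T : Series V → Series V → Series V → Series W}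
    (h₁ : ∀ y z, ShiftAdditive fun x => T x y z) (h₂ : ∀ x z, ShiftAdditive fun y => T x y z)
    (h₃ : ∀ x y, ShiftAdditive fun z => T x y z) {N : ℕ}
    (h : ∀ a b c, AgreeBelow N (T (constSeries a) (constSeries b) (constSeries c)) 0)
    (x y z : Series V) :
    AgreeBelow N (T x y z) 0 ∧
      T x y z N = T (constSeries (x 0)) (constSeries (y 0)) (constSeries (z 0)) N := by
  have h' := fun a => ShiftAdditive.leading₂ (h₂ (constSeries a)) (h₃ (constSeries a)) (h a)
  have h'' : ∀ y z a, AgreeBelow N (T (constSeries a) y z) 0 := fun y z a => (h' a y z).1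
  exact ⟨(h₁ y z).below (h'' y z) x, ((h₁ y z).leading (h'' y z) x).trans (h' _ y z).2⟩

variable (F : Side → ℕ → V →ₗ[K] V →ₗ[K] V) (G : Side → ℕ → W →ₗ[K] W →ₗ[K] W)
  (g : ℕ → V →ₗ[K] W)

/-- The associator of a power series of pairs of bilinear maps. -/
abbrev seriesAssociator (y : Y 3) (a b c : Series V) : Series V :=
  associator (fun s => extendBilin (F s)) y a b c

/-- The failure of a power series of linear maps to be a morphism. -/
abbrev seriesDefect (y : Y 2) (a b : Series V) : Series W :=
  morDefect (fun s => extendBilin (F s)) (fun s => extendBilin (G s)) (extendLin g) y a b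

/-- The associator is additive in each variable and commutes with `t`, so its leading coefficient
depends only on constant terms. This turns conditions on `D⟦t⟧` into conditions on cochains of `D`.
-/
theorem seriesAssociator_leading {N : ℕ} {y : Y 3}
    (h : ∀ a b c, AgreeBelow N
      (seriesAssociator F y (constSeries a) (constSeries b) (constSeries c)) 0)
    (a b c : Series V) :
    AgreeBelow N (seriesAssociator F y a b c) 0 ∧ seriesAssociator F y a b c N =
      seriesAssociator F y (constSeries (a 0)) (constSeries (b 0)) (constSeries (c 0)) N := by
  refine ShiftAdditive.leading₃ (fun _ _ => ⟨fun _ _ => ?_, fun _ => ?_⟩)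
    (fun _ _ => ⟨fun _ _ => ?_, fun _ => ?_⟩) (fun _ _ => ⟨fun _ _ => ?_, fun _ => ?_⟩) h a b c
  all_goals
    simp only [seriesAssociator, associator, map_add, LinearMap.add_apply, shift_sub,
      extendBilin_shift_left, extendBilin_shift_right]
  all_goals abel

theorem seriesDefect_leading {N : ℕ} {y : Y 2}
    (h : ∀ a b, AgreeBelow N (seriesDefect F G g y (constSeries a) (constSeries b)) 0)
    (a b : Series V) :
    AgreeBelow N (seriesDefect F G g y a b) 0 ∧ seriesDefect F G g y a b N =
      seriesDefect F G g y (constSeries (a 0)) (constSeries (b 0)) N := by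
  refine ShiftAdditive.leading₂ (fun _ => ⟨fun _ _ => ?_, fun _ => ?_⟩)
    (fun _ => ⟨fun _ _ => ?_, fun _ => ?_⟩) h a b
  all_goals
    simp only [seriesDefect, morDefect, map_add, LinearMap.add_apply, shift_sub,
      extendBilin_shift_left, extendBilin_shift_right, extendLin_shift]
  all_goals abel

end SeriesLemmas

/-! ### Cochains of low degree -/

section LowDegree

variable {K V W : Type*} [Field K] [AddCommGroup V] [Module K V] [AddCommGroup W] [Module K W]
  {A : Dialgebra K V}

theorem coboundary_one_apply (R : Representation A W) (f : CY K V W 1) (y : Y 2) (a : Fin 2 → V) :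
    coboundary R 1 f y a = R.lact (firstSide y.1) (a 0) (f (d 0 y) ![a 1])
      - f (d 1 y) ![A.op (leafSide y.1 1) (a 0) (a 1)]
      + R.ract (lastSide y.1) (f (d 2 y) ![a 0]) (a 1) := by
  have h0 : (fun k : Fin 1 => a k.succ) = ![a 1] := by
    funext k; fin_cases k; rfl
  have h1 : ∀ s, Fin.contractNth (0 : Fin 1).castSucc (fun u v => A.op s u v) a
      = ![A.op s (a 0) (a 1)] := fun s => by
    funext k; fin_cases k; rfl
  have h2 : (fun k : Fin 1 => a k.castSucc) = ![a 0] := by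
    funext k; fin_cases k; rfl
  have : coboundary R 1 f y a = cofaceFirst R f y a +
      (-1 : K) ^ 1 • cofaceMid A (0 : Fin 1) f y a + (-1 : K) ^ 2 • cofaceLast R f y a := by
    simp [coboundary]
  rw [this, cofaceFirst_apply, cofaceMid_apply, cofaceLast_apply, h0, h2]
  -- The face index `(0 : Fin 1).succ.castSucc` and the leaf number `0 + 1` are definitionally the
  -- literal `1`.
  change _ + _ • f (d 1 y) (Fin.contractNth (0 : Fin 1).castSucc
    (fun u v => A.op (leafSide y.1 1) u v) a) + _ • R.ract _ (f (d 2 y) _) (a 1) = _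
  rw [h1]
  module

theorem coboundary_two_apply (R : Representation A W) (f : CY K V W 2) (y : Y 3) (a : Fin 3 → V) :
    coboundary R 2 f y a = R.lact (firstSide y.1) (a 0) (f (d 0 y) ![a 1, a 2])
      - f (d 1 y) ![A.op (leafSide y.1 1) (a 0) (a 1), a 2]
      + f (d 2 y) ![a 0, A.op (leafSide y.1 2) (a 1) (a 2)]
      - R.ract (lastSide y.1) (f (d 3 y) ![a 0, a 1]) (a 2) := by
  have h0 : (fun k : Fin 2 => a k.succ) = ![a 1, a 2] := by
    funext k; fin_cases k <;> rfl
  have h1 : Fin.contractNth (0 : Fin 2).castSucc (fun u v => A.op (leafSide y.1 1) u v) a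
      = ![A.op (leafSide y.1 1) (a 0) (a 1), a 2] := by
    funext k; fin_cases k <;> rfl
  have h2 : Fin.contractNth (1 : Fin 2).castSucc (fun u v => A.op (leafSide y.1 2) u v) a
      = ![a 0, A.op (leafSide y.1 2) (a 1) (a 2)] := by
    funext k; fin_cases k <;> rfl
  have h3 : (fun k : Fin 2 => a k.castSucc) = ![a 0, a 1] := by
    funext k; fin_cases k <;> rfl
  have : coboundary R 2 f y a = cofaceFirst R f y a +
      ((-1 : K) ^ 1 • cofaceMid A (0 : Fin 2) f y a + (-1 : K) ^ 2 • cofaceMid A (1 : Fin 2) f y a)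
      + (-1 : K) ^ 3 • cofaceLast R f y a := by
    simp [coboundary, Fin.sum_univ_two]
  rw [this, cofaceFirst_apply, cofaceMid_apply, cofaceMid_apply, cofaceLast_apply, h0, h3]
  change _ + (_ • f (d 1 y) (Fin.contractNth (0 : Fin 2).castSucc
    (fun u v => A.op (leafSide y.1 1) u v) a) + _ • f (d 2 y) (Fin.contractNth (1 : Fin 2).castSucc
    (fun u v => A.op (leafSide y.1 2) u v) a)) + _ • R.ract _ (f (d 3 y) _) (a 2) = _
  rw [h1, h2]
  module

theorem coboundary_three_apply (R : Representation A W) (f : CY K V W 3) (y : Y 4)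
    (a : Fin 4 → V) :
    coboundary R 3 f y a = R.lact (firstSide y.1) (a 0) (f (d 0 y) ![a 1, a 2, a 3])
      - f (d 1 y) ![A.op (leafSide y.1 1) (a 0) (a 1), a 2, a 3]
      + f (d 2 y) ![a 0, A.op (leafSide y.1 2) (a 1) (a 2), a 3]
      - f (d 3 y) ![a 0, a 1, A.op (leafSide y.1 3) (a 2) (a 3)]
      + R.ract (lastSide y.1) (f (d 4 y) ![a 0, a 1, a 2]) (a 3) := by
  have h0 : (fun k : Fin 3 => a k.succ) = ![a 1, a 2, a 3] := by
    funext k; fin_cases k <;> rfl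
  have h1 : Fin.contractNth (0 : Fin 3).castSucc (fun u v => A.op (leafSide y.1 1) u v) a
      = ![A.op (leafSide y.1 1) (a 0) (a 1), a 2, a 3] := by
    funext k; fin_cases k <;> rfl
  have h2 : Fin.contractNth (1 : Fin 3).castSucc (fun u v => A.op (leafSide y.1 2) u v) a
      = ![a 0, A.op (leafSide y.1 2) (a 1) (a 2), a 3] := by
    funext k; fin_cases k <;> rfl
  have h3 : Fin.contractNth (2 : Fin 3).castSucc (fun u v => A.op (leafSide y.1 3) u v) a
      = ![a 0, a 1, A.op (leafSide y.1 3) (a 2) (a 3)] := by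
    funext k; fin_cases k <;> rfl
  have h4 : (fun k : Fin 3 => a k.castSucc) = ![a 0, a 1, a 2] := by
    funext k; fin_cases k <;> rfl
  have : coboundary R 3 f y a = cofaceFirst R f y a +
      ((-1 : K) ^ 1 • cofaceMid A (0 : Fin 3) f y a + (-1 : K) ^ 2 • cofaceMid A (1 : Fin 3) f y a
        + (-1 : K) ^ 3 • cofaceMid A (2 : Fin 3) f y a)
      + (-1 : K) ^ 4 • cofaceLast R f y a := by
    simp [coboundary, Fin.sum_univ_three]
  rw [this, cofaceFirst_apply, cofaceMid_apply, cofaceMid_apply, cofaceMid_apply,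
    cofaceLast_apply, h0, h4]
  change _ + (_ • f (d 1 y) (Fin.contractNth (0 : Fin 3).castSucc
    (fun u v => A.op (leafSide y.1 1) u v) a) + _ • f (d 2 y) (Fin.contractNth (1 : Fin 3).castSucc
    (fun u v => A.op (leafSide y.1 2) u v) a) + _ • f (d 3 y) (Fin.contractNth (2 : Fin 3).castSucc
    (fun u v => A.op (leafSide y.1 3) u v) a)) + _ • R.ract _ (f (d 4 y) _) (a 3) = _
  rw [h1, h2, h3]
  module

theorem selfRep_lact (s : Side) (x m : V) : A.selfRep.lact s x m = A.op s x m := by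
  cases s <;> rfl

theorem selfRep_ract (s : Side) (x m : V) : A.selfRep.ract s m x = A.op s m x := by
  cases s <;> rfl

theorem rep_lact {B : Dialgebra K W} (ψ : Morphism A B) (s : Side) (x : V) (m : W) :
    ψ.rep.lact s x m = B.op s (ψ.toLinearMap x) m := by
  cases s <;> rfl

theorem rep_ract {B : Dialgebra K W} (ψ : Morphism A B) (s : Side) (x : V) (m : W) :
    ψ.rep.ract s m x = B.op s m (ψ.toLinearMap x) := by
  cases s <;> rfl

/-! ### Cochains of degree one and two as linear and bilinear maps. -/

/-- The `2`-cochain given by a pair of bilinear maps. -/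
def bilinCochain (P : Side → V →ₗ[K] V →ₗ[K] W) : CY K V W 2 :=
  fun y => bilinToMultilin (P (treeSide y))

/-- The tree in `Y_2` attached to an operation symbol. -/
def sideTree : Side → Y 2
  | .left => t21
  | .right => t12

theorem treeSide_sideTree (s : Side) : treeSide (sideTree s) = s := by
  cases s
  · exact treeSide_t21
  · exact treeSide_t12

theorem sideTree_treeSide (y : Y 2) : sideTree (treeSide y) = y := by
  rcases Y_two_cases y with rfl | rfl
  · rw [treeSide_t21]; rfl
  · rw [treeSide_t12]; rfl

theorem sides_two (y : Y 2) :
    firstSide y.1 = treeSide y ∧ leafSide y.1 1 = treeSide y ∧ lastSide y.1 = treeSide y := by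
  rcases Y_two_cases y with rfl | rfl <;> exact ⟨rfl, rfl, rfl⟩

theorem vec_two {V : Type*} (a : Fin 2 → V) : ![a 0, a 1] = a := by
  funext k; fin_cases k <;> rfl

theorem update_vec_zero {V : Type*} (a b x : V) : Function.update ![a, b] 0 x = ![x, b] := by
  funext k; fin_cases k <;> rfl

theorem update_vec_one {V : Type*} (a b x : V) : Function.update ![a, b] 1 x = ![a, x] := by
  funext k; fin_cases k <;> rfl

/-- The pair of bilinear maps given by a `2`-cochain. -/
def cochainBilin : CY K V W 2 →+ (Side → V →ₗ[K] V →ₗ[K] W) where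
  toFun f s := LinearMap.mk₂ K (fun a b => f (sideTree s) ![a, b])
    (fun a a' b => by
      have h := (f (sideTree s)).map_update_add ![a, b] 0 a a'
      rwa [update_vec_zero, update_vec_zero, update_vec_zero] at h)
    (fun c a b => by
      have h := (f (sideTree s)).map_update_smul ![a, b] 0 c a
      rwa [update_vec_zero, update_vec_zero] at h)
    (fun a b b' => by
      have h := (f (sideTree s)).map_update_add ![a, b] 1 b b'
      rwa [update_vec_one, update_vec_one, update_vec_one] at h)
    (fun c a b => by
      have h := (f (sideTree s)).map_update_smul ![a, b] 1 c b
      rwa [update_vec_one, update_vec_one] at h)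
  map_zero' := by funext s; ext; simp
  map_add' f g := by funext s; ext; simp

theorem cochainBilin_apply (f : CY K V W 2) (s : Side) (a b : V) :
    cochainBilin f s a b = f (sideTree s) ![a, b] := rfl

theorem cochainBilin_treeSide (f : CY K V W 2) (y : Y 2) (a b : V) :
    cochainBilin f (treeSide y) a b = f y ![a, b] := by
  rw [cochainBilin_apply, sideTree_treeSide]

theorem bilinCochain_cochainBilin (f : CY K V W 2) : bilinCochain (cochainBilin f) = f := by
  funext y
  ext a
  rw [← vec_two a]
  exact cochainBilin_treeSide f y _ _

theorem cochainBilin_bilinCochain (P : Side → V →ₗ[K] V →ₗ[K] W) :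
    cochainBilin (bilinCochain P) = P := by
  funext s
  ext a b
  rw [cochainBilin_apply, bilinCochain, treeSide_sideTree]
  rfl

/-- The linear map given by a `1`-cochain. -/
def cochainLin : CY K V W 1 →+ (V →ₗ[K] W) where
  toFun f := (MultilinearMap.ofSubsingleton K V W (0 : Fin 1)).symm (f ⟨.node () .nil .nil, rfl⟩)
  map_zero' := by ext; simp
  map_add' f g := by ext; simp

theorem cochainLin_apply (f : CY K V W 1) (y : Y 1) (a : V) : cochainLin f a = f y ![a] := by
  obtain ⟨t, ht⟩ := y
  obtain rfl := tree_cases_one ht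
  change f _ _ = f _ _
  congr 1
  funext k; fin_cases k; rfl

theorem oneCochain_cochainLin (f : CY K V W 1) : oneCochain (cochainLin f) = f := by
  funext y
  ext a
  have : a = ![a 0] := by funext k; fin_cases k; rfl
  rw [this]
  exact cochainLin_apply f y _

theorem cochainLin_oneCochain (g : V →ₗ[K] W) : cochainLin (oneCochain g) = g := by
  ext a
  rw [cochainLin_apply _ ⟨.node () .nil .nil, rfl⟩]
  rfl

end LowDegree

/-! ### First-order change of the associators -/

section Perturbation

variable {K V W : Type*} [Field K] [AddCommGroup V] [Module K V] [AddCommGroup W] [Module K W]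

theorem extendBilin_add (F G : ℕ → V →ₗ[K] V →ₗ[K] V) :
    extendBilin (F + G) = extendBilin F + extendBilin G := by
  ext x y n
  simp [extendBilin_apply, Finset.sum_add_distrib]

theorem extendLin_add (g h : ℕ → V →ₗ[K] W) : extendLin (g + h) = extendLin g + extendLin h := by
  ext x n
  simp [extendLin_apply, Finset.sum_add_distrib]

theorem agreeBelow_single (N : ℕ) (v : V) : AgreeBelow N (Pi.single N v) 0 := by
  intro n hn
  simp [hn.ne]

/-- By degree count: `x` already uses up `t^N`, so `F` and `y` contribute only constant terms. This
is how the undeformed operations appear in the obstruction. -/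
theorem extendBilin_order (F : ℕ → V →ₗ[K] V →ₗ[K] V) {N : ℕ} {x : Series V} (y : Series V)
    (hx : AgreeBelow N x 0) : extendBilin F x y N = F 0 (x N) (y 0) := by
  simpa using extendBilin_leading 0 N 0 (agreeBelow_zero F 0) hx (agreeBelow_zero y 0)

theorem extendBilin_order_right (F : ℕ → V →ₗ[K] V →ₗ[K] V) {N : ℕ} (x : Series V)
    {y : Series V} (hy : AgreeBelow N y 0) : extendBilin F x y N = F 0 (x 0) (y N) := by
  simpa using extendBilin_leading 0 0 N (agreeBelow_zero F 0) (agreeBelow_zero x 0) hy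

theorem extendBilin_zero_coeff (F : ℕ → V →ₗ[K] V →ₗ[K] V) (x y : Series V) :
    extendBilin F x y 0 = F 0 (x 0) (y 0) :=
  extendBilin_order F y (agreeBelow_zero x 0)

theorem extendLin_order (g : ℕ → V →ₗ[K] W) {N : ℕ} {x : Series V} (hx : AgreeBelow N x 0) :
    extendLin g x N = g 0 (x N) := by
  simpa using extendLin_leading 0 N (agreeBelow_zero g 0) hx

theorem extendLin_zero_coeff (g : ℕ → V →ₗ[K] W) (x : Series V) :
    extendLin g x 0 = g 0 (x 0) :=
  extendLin_order g (agreeBelow_zero x 0)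

theorem extendBilin_single_apply (N : ℕ) (P : V →ₗ[K] V →ₗ[K] V) (x y : Series V) :
    extendBilin (Pi.single N P) x y N = P (x 0) (y 0) := by
  simpa using extendBilin_leading N 0 0 (agreeBelow_single N P) (agreeBelow_zero x 0)
    (agreeBelow_zero y 0)

theorem extendBilin_single_below (N : ℕ) (P : V →ₗ[K] V →ₗ[K] V) (x y : Series V) :
    AgreeBelow N (extendBilin (Pi.single N P) x y) 0 := by
  simpa using extendBilin_below N 0 0 (agreeBelow_single N P) (agreeBelow_zero x 0)
    (agreeBelow_zero y 0)

theorem extendLin_single_apply (N : ℕ) (h : V →ₗ[K] W) (x : Series V) :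
    extendLin (Pi.single N h) x N = h (x 0) := by
  simpa using extendLin_leading N 0 (agreeBelow_single N h) (agreeBelow_zero x 0)

theorem extendLin_single_below (N : ℕ) (h : V →ₗ[K] W) (x : Series V) :
    AgreeBelow N (extendLin (Pi.single N h) x) 0 := by
  simpa using extendLin_below N 0 (agreeBelow_single N h) (agreeBelow_zero x 0)

theorem seriesAssociator_add_single (F : Side → ℕ → V →ₗ[K] V →ₗ[K] V)
    (P : Side → V →ₗ[K] V →ₗ[K] V) {N : ℕ} (hN : 0 < N) (y : Y 3) (a b c : Series V) :
    seriesAssociator (fun s => F s + Pi.single N (P s)) y a b c N =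
      seriesAssociator F y a b c N
      + (F (treeSide (d 1 y)) 0 (P (treeSide (d 3 y)) (a 0) (b 0)) (c 0)
      + P (treeSide (d 1 y)) (F (treeSide (d 3 y)) 0 (a 0) (b 0)) (c 0)
      - F (treeSide (d 2 y)) 0 (a 0) (P (treeSide (d 0 y)) (b 0) (c 0))
      - P (treeSide (d 2 y)) (a 0) (F (treeSide (d 0 y)) 0 (b 0) (c 0))) := by
  simp only [seriesAssociator, associator, extendBilin_add, map_add, LinearMap.add_apply,
    Pi.add_apply, Pi.sub_apply]
  rw [extendBilin_order _ _ (extendBilin_single_below N _ _ _),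
    extendBilin_order_right _ _ (extendBilin_single_below N _ _ _)]
  -- The terms quadratic in `P` contain the constant coefficient of `Pi.single N (P s)`, which is
  -- zero because `N > 0`.
  simp only [extendBilin_single_apply, extendBilin_zero_coeff, Pi.single_eq_of_ne hN.ne, map_zero,
    LinearMap.zero_apply]
  abel

theorem seriesDefect_add_single (F : Side → ℕ → V →ₗ[K] V →ₗ[K] V)
    (G : Side → ℕ → W →ₗ[K] W →ₗ[K] W) (g : ℕ → V →ₗ[K] W)
    (P : Side → V →ₗ[K] V →ₗ[K] V) (Q : Side → W →ₗ[K] W →ₗ[K] W) (h : V →ₗ[K] W)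
    {N : ℕ} (hN : 0 < N) (y : Y 2) (a b : Series V) :
    seriesDefect (fun s => F s + Pi.single N (P s)) (fun s => G s + Pi.single N (Q s))
        (g + Pi.single N h) y a b N =
      seriesDefect F G g y a b N
      + (g 0 (P (treeSide y) (a 0) (b 0)) + h (F (treeSide y) 0 (a 0) (b 0))
      - G (treeSide y) 0 (h (a 0)) (g 0 (b 0)) - G (treeSide y) 0 (g 0 (a 0)) (h (b 0))
      - Q (treeSide y) (g 0 (a 0)) (g 0 (b 0))) := by
  have h1 : ∀ z : Series W, extendBilin (G (treeSide y)) (extendLin (Pi.single N h) a) z N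
      = G (treeSide y) 0 (h (a 0)) (z 0) := fun z => by
    rw [extendBilin_order _ _ (extendLin_single_below N _ _), extendLin_single_apply]
  have h2 : ∀ z : Series W, extendBilin (G (treeSide y)) z (extendLin (Pi.single N h) b) N
      = G (treeSide y) 0 (z 0) (h (b 0)) := fun z => by
    rw [extendBilin_order_right _ _ (extendLin_single_below N _ _), extendLin_single_apply]
  simp only [seriesDefect, morDefect, extendBilin_add, extendLin_add, map_add,
    LinearMap.add_apply, Pi.add_apply, Pi.sub_apply, h1, h2]
  rw [extendLin_order _ (extendBilin_single_below N _ _ _)]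
  simp only [extendBilin_single_apply, extendLin_single_apply, extendBilin_zero_coeff,
    extendLin_zero_coeff, Pi.single_eq_of_ne hN.ne, map_zero, LinearMap.zero_apply]
  abel

end Perturbation

/-! ### Obstructions -/

section ObstructionCochains

variable {K V W : Type*} [Field K] [AddCommGroup V] [Module K V] [AddCommGroup W] [Module K W]

theorem constSeries_add (a b : V) : constSeries (a + b) = constSeries a + constSeries b :=
  Pi.single_add _ _ _

theorem constSeries_smul (c : K) (a : V) : constSeries (c • a) = c • constSeries a :=
  Pi.single_smul _ _ _

/-- The coefficient of `t^N` of the associator as a `3`-cochain. -/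
def assocCochain (F : Side → ℕ → V →ₗ[K] V →ₗ[K] V) (N : ℕ) : CY K V V 3 := fun y =>
  MultilinearMap.mk' (fun a => seriesAssociator F y (constSeries (a 0)) (constSeries (a 1))
      (constSeries (a 2)) N)
    (fun a i u v => by
      fin_cases i <;>
        simp [constSeries_add, seriesAssociator, associator] <;> abel)
    (fun a i c u => by
      fin_cases i <;>
        simp [constSeries_smul, seriesAssociator, associator, smul_sub])

/-- The coefficient of `t^N` of the failure to be a morphism as a `2`-cochain. -/
def defectCochain (F : Side → ℕ → V →ₗ[K] V →ₗ[K] V) (G : Side → ℕ → W →ₗ[K] W →ₗ[K] W)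
    (g : ℕ → V →ₗ[K] W) (N : ℕ) : CY K V W 2 := fun y =>
  MultilinearMap.mk' (fun a => seriesDefect F G g y (constSeries (a 0)) (constSeries (a 1)) N)
    (fun a i u v => by
      fin_cases i <;> simp [constSeries_add, seriesDefect, morDefect] <;> abel)
    (fun a i c u => by
      fin_cases i <;> simp [constSeries_smul, seriesDefect, morDefect, smul_sub])

theorem assocCochain_apply (F : Side → ℕ → V →ₗ[K] V →ₗ[K] V) (N : ℕ) (y : Y 3) (a : Fin 3 → V) :
    assocCochain F N y a = seriesAssociator F y (constSeries (a 0)) (constSeries (a 1))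
      (constSeries (a 2)) N := rfl

theorem defectCochain_apply (F : Side → ℕ → V →ₗ[K] V →ₗ[K] V) (G : Side → ℕ → W →ₗ[K] W →ₗ[K] W)
    (g : ℕ → V →ₗ[K] W) (N : ℕ) (y : Y 2) (a : Fin 2 → V) :
    defectCochain F G g N y a =
      seriesDefect F G g y (constSeries (a 0)) (constSeries (a 1)) N := rfl

theorem seriesAssociator_of_below {F : Side → ℕ → V →ₗ[K] V →ₗ[K] V} {N : ℕ}
    (h : ∀ m < N, assocCochain F m = 0) (y : Y 3) (a b c : Series V) :
    AgreeBelow N (seriesAssociator F y a b c) 0 ∧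
      seriesAssociator F y a b c N = assocCochain F N y ![a 0, b 0, c 0] :=
  seriesAssociator_leading F (fun a b c m hm => by
    have := congrFun (h m hm) y
    exact DFunLike.congr_fun this ![a, b, c]) a b c

theorem seriesDefect_of_below {F : Side → ℕ → V →ₗ[K] V →ₗ[K] V}
    {G : Side → ℕ → W →ₗ[K] W →ₗ[K] W} {g : ℕ → V →ₗ[K] W} {N : ℕ}
    (h : ∀ m < N, defectCochain F G g m = 0) (y : Y 2) (a b : Series V) :
    AgreeBelow N (seriesDefect F G g y a b) 0 ∧
      seriesDefect F G g y a b N = defectCochain F G g N y ![a 0, b 0] :=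
  seriesDefect_leading F G g (fun a b m hm => by
    have := congrFun (h m hm) y
    exact DFunLike.congr_fun this ![a, b]) a b

/-- This is the coefficient of `t^N` in the pentagon identity for constant arguments. All
associators in it start at `t^N`, so the outer operations and the products inside the arguments
enter only through `F s 0`. -/
theorem coboundary_assocCochain (A : Dialgebra K V) {F : Side → ℕ → V →ₗ[K] V →ₗ[K] V}
    (h0 : ∀ s, F s 0 = A.op s) {N : ℕ} (h : ∀ m < N, assocCochain F m = 0) :
    coboundary A.selfRep 3 (assocCochain F N) = 0 := by
  funext y
  ext a
  have key := congrFun (associator_identity (fun s => extendBilin (F s)) y (constSeries (a 0))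
    (constSeries (a 1)) (constSeries (a 2)) (constSeries (a 3))) N
  have hA := seriesAssociator_of_below h
  simp only [Pi.add_apply, Pi.sub_apply] at key
  rw [extendBilin_order _ _ (hA _ _ _ _).1, extendBilin_order_right _ _ (hA _ _ _ _).1] at key
  simp only [(hA _ _ _ _).2, extendBilin_zero_coeff, constSeries_zero, h0] at key
  rw [coboundary_three_apply]
  simp only [selfRep_lact, selfRep_ract]
  exact key

/-- The coefficient of `t^N` in `morDefect_identity`. The lower associators must vanish as well, so
that `g` acts on the associator of `F` through `g 0` and that of `G` sees only the constant terms of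
its arguments. -/
theorem coboundary_defectCochain {A : Dialgebra K V} {B : Dialgebra K W} (ψ : Morphism A B)
    {F : Side → ℕ → V →ₗ[K] V →ₗ[K] V} {G : Side → ℕ → W →ₗ[K] W →ₗ[K] W} {g : ℕ → V →ₗ[K] W}
    (hF : ∀ s, F s 0 = A.op s) (hG : ∀ s, G s 0 = B.op s) (hg : g 0 = ψ.toLinearMap) {N : ℕ}
    (hFN : ∀ m < N, assocCochain F m = 0) (hGN : ∀ m < N, assocCochain G m = 0)
    (h : ∀ m < N, defectCochain F G g m = 0) :
    coboundary ψ.rep 2 (defectCochain F G g N) =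
      pull ψ 3 (assocCochain G N) - push ψ 3 (assocCochain F N) := by
  funext y
  ext a
  have key := congrFun (morDefect_identity (fun s => extendBilin (F s))
    (fun s => extendBilin (G s)) (extendLin g) y (constSeries (a 0))
    (constSeries (a 1)) (constSeries (a 2))) N
  have hD := seriesDefect_of_below h
  have hA := seriesAssociator_of_below hFN
  have hB := seriesAssociator_of_below hGN
  simp only [Pi.add_apply, Pi.sub_apply] at key
  rw [extendBilin_order _ _ (hD _ _ _).1, extendBilin_order_right _ _ (hD _ _ _).1,
    extendLin_order _ (hA _ _ _ _).1] at key
  simp only [(hD _ _ _).2, (hA _ _ _ _).2, (hB _ _ _ _).2, extendBilin_zero_coeff,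
    extendLin_zero_coeff, constSeries_zero, hF, hG, hg] at key
  have ha : a = ![a 0, a 1, a 2] := by funext k; fin_cases k <;> rfl
  have hpa : (fun i => ψ.toLinearMap (a i)) =
      ![ψ.toLinearMap (a 0), ψ.toLinearMap (a 1), ψ.toLinearMap (a 2)] := by
    funext k; fin_cases k <;> rfl
  rw [coboundary_two_apply]
  simp only [rep_lact, rep_ract, key]
  change _ = assocCochain G N y (fun i => ψ.toLinearMap (a i))
    - ψ.toLinearMap (assocCochain F N y a)
  rw [hpa, ← ha]

theorem assocCochain_add_single (A : Dialgebra K V) {F : Side → ℕ → V →ₗ[K] V →ₗ[K] V}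
    (h0 : ∀ s, F s 0 = A.op s) (f : CY K V V 2) {N : ℕ} (hN : 0 < N) :
    assocCochain (fun s => F s + Pi.single N (cochainBilin f s)) N =
      assocCochain F N - coboundary A.selfRep 2 f := by
  funext y
  ext a
  obtain ⟨s0, s1, s2, s3⟩ := sides_three y
  change assocCochain _ N y a = assocCochain F N y a - coboundary A.selfRep 2 f y a
  rw [assocCochain_apply, seriesAssociator_add_single F _ hN, assocCochain_apply,
    coboundary_two_apply]
  simp only [constSeries_zero, h0, cochainBilin_treeSide, selfRep_lact, selfRep_ract, s0, s1, s2,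
    s3]
  abel

/-- The change is plus the third component of the deformation coboundary, whereas associators change
by minus a coboundary. Hence the sign on the defect in `obstruction`. -/
theorem defectCochain_add_single {A : Dialgebra K V} {B : Dialgebra K W} (ψ : Morphism A B)
    {F : Side → ℕ → V →ₗ[K] V →ₗ[K] V} {G : Side → ℕ → W →ₗ[K] W →ₗ[K] W} {g : ℕ → V →ₗ[K] W}
    (hF : ∀ s, F s 0 = A.op s) (hG : ∀ s, G s 0 = B.op s) (hg : g 0 = ψ.toLinearMap)
    (f : CY K V V 2) (f' : CY K W W 2) (h : CY K V W 1) {N : ℕ} (hN : 0 < N) :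
    defectCochain (fun s => F s + Pi.single N (cochainBilin f s))
        (fun s => G s + Pi.single N (cochainBilin f' s)) (g + Pi.single N (cochainLin h)) N =
      defectCochain F G g N + (push ψ 2 f - pull ψ 2 f' - coboundary ψ.rep 1 h) := by
  funext y
  ext a
  obtain ⟨s0, s1, s2⟩ := sides_two y
  change defectCochain _ _ _ N y a = defectCochain F G g N y a
    + (ψ.toLinearMap (f y a) - f' y (fun i => ψ.toLinearMap (a i)) - coboundary ψ.rep 1 h y a)
  have hpa : (fun i => ψ.toLinearMap (a i)) = ![ψ.toLinearMap (a 0), ψ.toLinearMap (a 1)] := by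
    funext k; fin_cases k <;> rfl
  rw [defectCochain_apply, seriesDefect_add_single F G g _ _ _ hN, defectCochain_apply,
    coboundary_one_apply, hpa]
  simp only [constSeries_zero, hF, hG, hg, cochainBilin_treeSide, rep_lact, rep_ract, s0, s1, s2,
    ← cochainLin_apply, vec_two]
  abel

/-! ### Dependence on coefficients up to degree `N` only. -/

theorem assocCochain_congr {F F' : Side → ℕ → V →ₗ[K] V →ₗ[K] V} {N : ℕ}
    (h : ∀ s, AgreeBelow (N + 1) (F s) (F' s)) : assocCochain F N = assocCochain F' N := by
  funext y
  ext a
  have hr : ∀ x : Series V, AgreeBelow (N + 1) x x := fun _ _ _ => rfl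
  exact congrArg₂ (· - ·)
    ((h _).extendBilin ((h _).extendBilin (hr _) (hr _)) (hr _) N N.lt_succ_self)
    ((h _).extendBilin (hr _) ((h _).extendBilin (hr _) (hr _)) N N.lt_succ_self)

theorem defectCochain_congr {F F' : Side → ℕ → V →ₗ[K] V →ₗ[K] V}
    {G G' : Side → ℕ → W →ₗ[K] W →ₗ[K] W} {g g' : ℕ → V →ₗ[K] W} {N : ℕ}
    (hF : ∀ s, AgreeBelow (N + 1) (F s) (F' s)) (hG : ∀ s, AgreeBelow (N + 1) (G s) (G' s))
    (hg : AgreeBelow (N + 1) g g') : defectCochain F G g N = defectCochain F' G' g' N := by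
  funext y
  ext a
  have hr : ∀ x : Series V, AgreeBelow (N + 1) x x := fun _ _ _ => rfl
  exact congrArg₂ (· - ·)
    (hg.extendLin ((hF _).extendBilin (hr _) (hr _)) N N.lt_succ_self)
    ((hG _).extendBilin (hg.extendLin (hr _)) (hg.extendLin (hr _)) N N.lt_succ_self)

/-! ### The undeformed structure has no obstructions. -/

theorem constSeries_of_ne (a : V) {n : ℕ} (hn : n ≠ 0) : constSeries a n = 0 :=
  Pi.single_eq_of_ne hn _

theorem extendBilin_const_of_coeff_eq_zero {F : ℕ → V →ₗ[K] V →ₗ[K] V} (hF : ∀ n, n ≠ 0 → F n = 0)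
    (a b : V) : extendBilin F (constSeries a) (constSeries b) = constSeries (F 0 a b) := by
  funext n
  obtain rfl | hn := eq_or_ne n 0
  · simp [extendBilin_zero_coeff, constSeries_zero]
  · rw [extendBilin_apply, constSeries_of_ne _ hn]
    refine Finset.sum_eq_zero fun p hp => Finset.sum_eq_zero fun q hq => ?_
    rw [Finset.HasAntidiagonal.mem_antidiagonal] at hp hq
    obtain h | h | h : p.1 ≠ 0 ∨ q.1 ≠ 0 ∨ q.2 ≠ 0 := by omega
    · simp [hF _ h]
    · simp [constSeries_of_ne _ h]
    · simp [constSeries_of_ne _ h]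

theorem extendLin_const_of_coeff_eq_zero {g : ℕ → V →ₗ[K] W} (hg : ∀ n, n ≠ 0 → g n = 0) (a : V) :
    extendLin g (constSeries a) = constSeries (g 0 a) := by
  funext n
  obtain rfl | hn := eq_or_ne n 0
  · simp [extendLin_zero_coeff, constSeries_zero]
  · rw [extendLin_apply, constSeries_of_ne _ hn]
    refine Finset.sum_eq_zero fun p hp => ?_
    rw [Finset.HasAntidiagonal.mem_antidiagonal] at hp
    obtain h | h : p.1 ≠ 0 ∨ p.2 ≠ 0 := by omega
    · simp [hg _ h]
    · simp [constSeries_of_ne _ h]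

theorem Dialgebra.associator_op (A : Dialgebra K V) (y : Y 3) (a b c : V) :
    associator A.op y a b c = 0 :=
  (isDialgebra_iff A.op).1 A.isDialgebra y a b c

theorem Morphism.map_op {A : Dialgebra K V} {B : Dialgebra K W} (ψ : Morphism A B) (s : Side)
    (a b : V) : ψ.toLinearMap (A.op s a b) = B.op s (ψ.toLinearMap a) (ψ.toLinearMap b) := by
  cases s
  · exact ψ.isMorphism.map_lprod a b
  · exact ψ.isMorphism.map_rprod a b

theorem assocCochain_trivial (A : Dialgebra K V) {F : Side → ℕ → V →ₗ[K] V →ₗ[K] V}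
    (h0 : ∀ s, F s 0 = A.op s) (hF : ∀ s n, n ≠ 0 → F s n = 0) (N : ℕ) :
    assocCochain F N = 0 := by
  funext y
  ext a
  rw [assocCochain_apply, seriesAssociator, associator]
  simp only [extendBilin_const_of_coeff_eq_zero (hF _), h0]
  have h := A.associator_op y (a 0) (a 1) (a 2)
  rw [associator, sub_eq_zero] at h
  rw [h, sub_self]
  rfl

theorem defectCochain_trivial {A : Dialgebra K V} {B : Dialgebra K W} (ψ : Morphism A B)
    {F : Side → ℕ → V →ₗ[K] V →ₗ[K] V} {G : Side → ℕ → W →ₗ[K] W →ₗ[K] W} {g : ℕ → V →ₗ[K] W}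
    (hF : ∀ s, F s 0 = A.op s) (hG : ∀ s, G s 0 = B.op s) (hg : g 0 = ψ.toLinearMap)
    (hF' : ∀ s n, n ≠ 0 → F s n = 0) (hG' : ∀ s n, n ≠ 0 → G s n = 0)
    (hg' : ∀ n, n ≠ 0 → g n = 0) (N : ℕ) : defectCochain F G g N = 0 := by
  funext y
  ext a
  rw [defectCochain_apply, seriesDefect, morDefect]
  simp only [extendBilin_const_of_coeff_eq_zero (hF' _), extendBilin_const_of_coeff_eq_zero (hG' _),
    extendLin_const_of_coeff_eq_zero hg', hF, hG, hg, ψ.map_op, sub_self]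
  rfl

end ObstructionCochains

/-! ### Construction of the deformation -/

section Construction

variable {K D E : Type*} [Field K] [AddCommGroup D] [Module K D] [AddCommGroup E] [Module K E]
  {A : Dialgebra K D} {B : Dialgebra K E} {ψ : Morphism A B}

/-- The power series of pairs of bilinear maps on `D` given by a sequence of `2`-cochains. -/
def sourceCoeff (θ : ℕ → DefCochain ψ 2) (s : Side) (n : ℕ) : D →ₗ[K] D →ₗ[K] D :=
  cochainBilin (θ n).1 s

/-- The power series of pairs of bilinear maps on `E` given by a sequence of `2`-cochains. -/
def targetCoeff (θ : ℕ → DefCochain ψ 2) (s : Side) (n : ℕ) : E →ₗ[K] E →ₗ[K] E :=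
  cochainBilin (θ n).2.1 s

/-- The power series of linear maps given by a sequence of `2`-cochains. -/
def mapCoeff (θ : ℕ → DefCochain ψ 2) (n : ℕ) : D →ₗ[K] E :=
  cochainLin (V := D) (θ n).2.2

/-- The `2`-cochain of the undeformed structure. -/
def structureCochain (ψ : Morphism A B) : DefCochain ψ 2 :=
  (bilinCochain A.op, bilinCochain B.op, oneCochain ψ.toLinearMap)

/-- The obstruction in degree `N` of a sequence of `2`-cochains. -/
def obstruction (θ : ℕ → DefCochain ψ 2) (N : ℕ) : DefCochain ψ 3 :=
  (assocCochain (sourceCoeff θ) N, assocCochain (targetCoeff θ) N,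
    (-defectCochain (sourceCoeff θ) (targetCoeff θ) (mapCoeff θ) N : CY K D E 2))

theorem obstruction_eq_zero_iff {θ : ℕ → DefCochain ψ 2} {N : ℕ} :
    obstruction θ N = 0 ↔ assocCochain (sourceCoeff θ) N = 0 ∧
      assocCochain (targetCoeff θ) N = 0 ∧
      defectCochain (sourceCoeff θ) (targetCoeff θ) (mapCoeff θ) N = 0 := by
  rw [obstruction, Prod.ext_iff, Prod.ext_iff]
  exact and_congr_right' (and_congr_right' neg_eq_zero)

theorem sourceCoeff_zero {θ : ℕ → DefCochain ψ 2} (h0 : θ 0 = structureCochain ψ) (s : Side) :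
    sourceCoeff θ s 0 = A.op s := by
  rw [sourceCoeff, h0]
  exact congrFun (cochainBilin_bilinCochain A.op) s

theorem targetCoeff_zero {θ : ℕ → DefCochain ψ 2} (h0 : θ 0 = structureCochain ψ) (s : Side) :
    targetCoeff θ s 0 = B.op s := by
  rw [targetCoeff, h0]
  exact congrFun (cochainBilin_bilinCochain B.op) s

theorem mapCoeff_zero {θ : ℕ → DefCochain ψ 2} (h0 : θ 0 = structureCochain ψ) :
    mapCoeff θ 0 = ψ.toLinearMap := by
  rw [mapCoeff, h0]
  exact cochainLin_oneCochain ψ.toLinearMap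

theorem obstruction_mem_cocycles {θ : ℕ → DefCochain ψ 2} (h0 : θ 0 = structureCochain ψ)
    {N : ℕ} (h : ∀ m < N, obstruction θ m = 0) :
    obstruction θ N ∈ cocycles ψ 3 := by
  simp only [obstruction_eq_zero_iff] at h
  rw [cocycles, LinearMap.mem_ker]
  refine Prod.ext ?_ (Prod.ext ?_ ?_)
  · exact coboundary_assocCochain A (sourceCoeff_zero h0) fun m hm => (h m hm).1
  · exact coboundary_assocCochain B (targetCoeff_zero h0) fun m hm => (h m hm).2.1
  · have key := coboundary_defectCochain ψ (sourceCoeff_zero h0) (targetCoeff_zero h0)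
      (mapCoeff_zero h0) (fun m hm => (h m hm).1) (fun m hm => (h m hm).2.1)
      (fun m hm => (h m hm).2.2)
    change push ψ 3 (assocCochain (sourceCoeff θ) N) - pull ψ 3 (assocCochain (targetCoeff θ) N)
      - coboundary ψ.rep 2 (-defectCochain (sourceCoeff θ) (targetCoeff θ) (mapCoeff θ) N) = 0
    rw [map_neg, key]
    abel

theorem obstruction_add_single {θ : ℕ → DefCochain ψ 2} (h0 : θ 0 = structureCochain ψ)
    (η : DefCochain ψ 2) {N : ℕ} (hN : 0 < N) :
    obstruction (θ + Pi.single N η) N = obstruction θ N - defCoboundary ψ 2 η := by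
  have hS : sourceCoeff (θ + Pi.single N η) =
      fun s => sourceCoeff θ s + Pi.single N (cochainBilin η.1 s) := by
    funext s n
    obtain rfl | hn := eq_or_ne n N <;> simp [sourceCoeff, *]
  have hT : targetCoeff (θ + Pi.single N η) =
      fun s => targetCoeff θ s + Pi.single N (cochainBilin η.2.1 s) := by
    funext s n
    obtain rfl | hn := eq_or_ne n N <;> simp [targetCoeff, *]
  have hM : mapCoeff (θ + Pi.single N η) =
      mapCoeff θ + Pi.single N (cochainLin (V := D) η.2.2) := by
    funext n
    obtain rfl | hn := eq_or_ne n N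
    -- The third component lives in `CYpred K D E 2`, which is `CY K D E 1` only by unfolding, so
    -- additivity is supplied up to definitional equality.
    · rw [Pi.add_apply, Pi.single_eq_same, mapCoeff, Pi.add_apply, Pi.single_eq_same]
      exact map_add cochainLin _ _
    · simp [mapCoeff, hn]
  rw [obstruction, hS, hT, hM]
  refine Prod.ext ?_ (Prod.ext ?_ ?_)
  · exact assocCochain_add_single A (sourceCoeff_zero h0) η.1 hN
  · exact assocCochain_add_single B (targetCoeff_zero h0) η.2.1 hN
  · have key := defectCochain_add_single ψ (sourceCoeff_zero h0) (targetCoeff_zero h0)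
      (mapCoeff_zero h0) η.1 η.2.1 η.2.2 hN
    refine (congrArg Neg.neg key).trans ?_
    rw [neg_add, ← sub_eq_add_neg]
    rfl

theorem obstruction_congr {θ θ' : ℕ → DefCochain ψ 2} {N : ℕ} (h : AgreeBelow (N + 1) θ θ') :
    obstruction θ N = obstruction θ' N := by
  have hS : ∀ s, AgreeBelow (N + 1) (sourceCoeff θ s) (sourceCoeff θ' s) := fun s n hn => by
    rw [sourceCoeff, h n hn, sourceCoeff]
  have hT : ∀ s, AgreeBelow (N + 1) (targetCoeff θ s) (targetCoeff θ' s) := fun s n hn => by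
    rw [targetCoeff, h n hn, targetCoeff]
  have hM : AgreeBelow (N + 1) (mapCoeff θ) (mapCoeff θ') := fun n hn => by
    rw [mapCoeff, h n hn, mapCoeff]
  rw [obstruction, obstruction, assocCochain_congr hS, assocCochain_congr hT,
    defectCochain_congr hS hT hM]

theorem obstruction_trivial (N : ℕ) :
    obstruction (Pi.single 0 (structureCochain ψ) : ℕ → DefCochain ψ 2) N = 0 := by
  have h0 : (Pi.single 0 (structureCochain ψ) : ℕ → DefCochain ψ 2) 0 = structureCochain ψ :=
    Pi.single_eq_same _ _
  have hn : ∀ n, n ≠ 0 → (Pi.single 0 (structureCochain ψ) : ℕ → DefCochain ψ 2) n = 0 :=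
    fun n hn => Pi.single_eq_of_ne hn _
  have hS : ∀ s n, n ≠ 0 → sourceCoeff (Pi.single 0 (structureCochain ψ)) s n = 0 :=
    fun s n h => by simp [sourceCoeff, hn n h]
  have hT : ∀ s n, n ≠ 0 → targetCoeff (Pi.single 0 (structureCochain ψ)) s n = 0 :=
    fun s n h => by simp [targetCoeff, hn n h]
  have hM : ∀ n, n ≠ 0 → mapCoeff (Pi.single 0 (structureCochain ψ)) n = 0 := fun n h => by
    rw [mapCoeff, hn n h]
    exact map_zero cochainLin
  exact obstruction_eq_zero_iff.2 ⟨assocCochain_trivial A (sourceCoeff_zero h0) hS N,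
    assocCochain_trivial B (targetCoeff_zero h0) hT N,
    defectCochain_trivial ψ (sourceCoeff_zero h0) (targetCoeff_zero h0) (mapCoeff_zero h0)
      hS hT hM N⟩

/-- Recovers a 2-cochain in the exact shape in which `Deformation.cochain` assembles it. -/
theorem ite_cochainBilin {V : Type*} [AddCommGroup V] [Module K V] (f : CY K V V 2) :
    (fun y => if y = t21 then bilinToMultilin (cochainBilin f .left)
      else bilinToMultilin (cochainBilin f .right)) = f := by
  conv_rhs => rw [← bilinCochain_cochainBilin f]
  funext y
  by_cases hy : y = t21 <;> simp [bilinCochain, treeSide, hy]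

/-- An unobstructed sequence of `2`-cochains is the sequence of coefficients of a deformation. -/
theorem exists_deformation {θ : ℕ → DefCochain ψ 2} (h0 : θ 0 = structureCochain ψ)
    (h : ∀ N, obstruction θ N = 0) : ∃ Θ : MorphismDeformation ψ, ∀ n, Θ.coeff n = θ n := by
  simp only [obstruction_eq_zero_iff] at h
  have hS : ∀ y a b c, seriesAssociator (sourceCoeff θ) y a b c = 0 := fun y a b c =>
    funext fun n =>
      -- The bound `n + 1` is the least that includes coefficient `n`; the same choice serves for
      -- `E` and the defect.
      (seriesAssociator_of_below (N := n + 1) (fun m _ => (h m).1) y a b c).1 n n.lt_succ_self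
  have hT : ∀ y a b c, seriesAssociator (targetCoeff θ) y a b c = 0 := fun y a b c =>
    funext fun n =>
      (seriesAssociator_of_below (N := n + 1) (fun m _ => (h m).2.1) y a b c).1 n n.lt_succ_self
  have hM : ∀ y a b, seriesDefect (sourceCoeff θ) (targetCoeff θ) (mapCoeff θ) y a b = 0 :=
    fun y a b => funext fun n =>
    (seriesDefect_of_below (N := n + 1) (fun m _ => (h m).2.2) y a b).1 n n.lt_succ_self
  refine ⟨⟨⟨sourceCoeff θ .left, sourceCoeff θ .right, sourceCoeff_zero h0 _,
      sourceCoeff_zero h0 _, (isDialgebra_iff _).2 hS⟩,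
    ⟨targetCoeff θ .left, targetCoeff θ .right, targetCoeff_zero h0 _,
      targetCoeff_zero h0 _, (isDialgebra_iff _).2 hT⟩,
    mapCoeff θ, mapCoeff_zero h0, ⟨fun x y => ?_, fun x y => ?_⟩⟩, fun n => ?_⟩
  · have := sub_eq_zero.1 (hM t21 x y)
    rwa [treeSide_t21] at this
  · have := sub_eq_zero.1 (hM t12 x y)
    rwa [treeSide_t12] at this
  · exact Prod.ext (ite_cochainBilin _) (Prod.ext (ite_cochainBilin _) (oneCochain_cochainLin _))

theorem mem_coboundaries_of_subsingleton {n : ℕ} (h : Subsingleton (HY ψ n)) {c : DefCochain ψ n}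
    (hc : c ∈ cocycles ψ n) : c ∈ coboundaries ψ n := by
  have : (coboundaries ψ n).submoduleOf (cocycles ψ n) = ⊤ :=
    Submodule.Quotient.subsingleton_iff.1 h
  exact (this ▸ Submodule.mem_top : (⟨c, hc⟩ : cocycles ψ n) ∈ (coboundaries ψ n).submoduleOf _)

/-- The place where the vanishing of cohomology acts: the obstruction is some `δη`, and adding `η`
in degree `N` subtracts exactly that. -/
theorem exists_obstruction_add_single_eq_zero (h : Subsingleton (HY ψ 3)) {θ : ℕ → DefCochain ψ 2}
    (h0 : θ 0 = structureCochain ψ) {N : ℕ} (hN : 0 < N) (hθ : ∀ m < N, obstruction θ m = 0) :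
    ∃ η, obstruction (θ + Pi.single N η) N = 0 := by
  obtain ⟨η, hη⟩ := mem_coboundaries_of_subsingleton h (obstruction_mem_cocycles h0 hθ)
  exact ⟨η, by rw [obstruction_add_single h0 η hN, hη, sub_self]⟩

theorem AgreeBelow.add_single {V : Type*} [AddCommGroup V] (x : ℕ → V) (N : ℕ) (v : V) :
    AgreeBelow N (x + Pi.single N v) x := fun n hn => by simp [hn.ne]

/-- The successive extensions of a first-order deformation. -/
theorem exists_unobstructed (h : Subsingleton (HY ψ 3)) {η : DefCochain ψ 2}
    (hη : η ∈ cocycles ψ 2) : ∃ θ : ℕ → DefCochain ψ 2,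
      θ 0 = structureCochain ψ ∧ θ 1 = η ∧ ∀ N, obstruction θ N = 0 := by
  -- The offset 2 reflects that the prescribed coefficients 0 and 1 already settle degrees 0 and 1;
  -- corrections begin in degree 2.
  let Good (N : ℕ) (θ : ℕ → DefCochain ψ 2) : Prop :=
    θ 0 = structureCochain ψ ∧ θ 1 = η ∧ ∀ m < N + 2, obstruction θ m = 0
  have hbase : Good 0 (Pi.single 0 (structureCochain ψ) + Pi.single 1 η) := by
    refine ⟨by simp, by simp, fun m hm => ?_⟩
    obtain rfl | rfl : m = 0 ∨ m = 1 := by omega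
    · rw [obstruction_congr (AgreeBelow.add_single _ 1 η), obstruction_trivial]
    -- In degree one the obstruction is `0 - δη`, so the cocycle condition is what makes the
    -- first-order deformation consistent.
    · rw [obstruction_add_single (Pi.single_eq_same _ _) η Nat.one_pos, obstruction_trivial,
        LinearMap.mem_ker.1 hη, sub_zero]
  have hstep : ∀ N θ, Good N θ → ∃ θ', Good (N + 1) θ' ∧ AgreeBelow (N + 2) θ' θ := by
    rintro N θ ⟨h0, h1, hθ⟩
    obtain ⟨ξ, hξ⟩ := exists_obstruction_add_single_eq_zero h h0 (Nat.succ_pos (N + 1)) hθ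
    have hagree := AgreeBelow.add_single θ (N + 2) ξ
    refine ⟨θ + Pi.single (N + 2) ξ, ⟨(hagree 0 (by omega)).trans h0,
      (hagree 1 (by omega)).trans h1, fun m hm => ?_⟩, hagree⟩
    obtain rfl | hm : m = N + 2 ∨ m < N + 2 := by omega
    · exact hξ
    · rw [obstruction_congr fun n hn => hagree n (by omega), hθ m hm]
  choose! next hgood hagree using hstep
  let S (N : ℕ) : ℕ → DefCochain ψ 2 :=
    Nat.rec (Pi.single 0 (structureCochain ψ) + Pi.single 1 η) next N
  have hS : ∀ N, Good N (S N) := fun N => by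
    induction N with
    | zero => exact hbase
    | succ N ih => exact hgood N _ ih
  have hmono : ∀ N k, AgreeBelow (N + 2) (S (N + k)) (S N) := fun N k => by
    induction k with
    | zero => exact fun _ _ => rfl
    | succ k ih => exact fun n hn => (hagree (N + k) _ (hS _) n (by omega)).trans (ih n hn)
  -- The diagonal is the limit of the stages: coefficient `n` no longer changes after stage `n`, so
  -- the limit agrees with `S N` through degree `N`.
  refine ⟨fun n => S n n, (hS 0).1, (hS 1).2.1, fun N => ?_⟩
  rw [← (hS N).2.2 N (by omega)]
  refine obstruction_congr fun n hn => ?_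
  obtain ⟨k, rfl⟩ := Nat.exists_eq_add_of_le (Nat.le_of_lt_succ hn)
  exact (hmono n k n (by omega)).symm

end Construction

end Dialg

theorem corollary6p3 {K D E : Type*} [Field K] [AddCommGroup D] [Module K D]
    [AddCommGroup E] [Module K E] (A : Dialg.Dialgebra K D) (B : Dialg.Dialgebra K E)
    (ψ : Dialg.Morphism A B) (h : Subsingleton (Dialg.HY ψ 3)) :
    ∀ θ ∈ Dialg.cocycles ψ 2, ∃ Θ : Dialg.MorphismDeformation ψ, Θ.infinitesimal = θ := by
  intro η hη
  obtain ⟨θ, h0, h1, hθ⟩ := Dialg.exists_unobstructed h hη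
  obtain ⟨Θ, hΘ⟩ := Dialg.exists_deformation h0 hθ
  exact ⟨Θ, (hΘ 1).trans h1⟩
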